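/- Theorem 1.4. **Setting.** The input is a finite nonempty simple undirected graph $G=(V,E)$ without isolated vertices, whose vertices carry distinct identifiers from $\mathbb N$; write $n=|V|$, $m=|E|$, and $d=2m/n$ for the average degree. A randomized, adaptive algorithm knows nothing about $G$ in advance (in particular not $n$) and accesses $G$ only through queries. In the *advanced model* the queries are: a uniformly random vertex, a uniformly random neighbour of a given vertex, the degree of a given vertex (each of cost $1$), and, for a given set $S\subseteq V$, the number of edges with both endpoints in $S$ (at cost $|S|$). In the stronger *full adjacency model* one may in addition ask, at cost $1$, for the whole set of neighbours of a given vertex. Random edges cannot be sampled in either model. "Number of queries" means the total cost of the queries. For $c\ge 1$, a value $v$ is a $c$-approximation to $d$ if $d/c\le v\le c\,d$. (a) There are constants $C>0$ and $k\in\mathbb N$ and, for every $\varepsilon\in(0,1)$, an algorithm in the advanced model, which only asks about vertices that it has already received in answers, such that on every input graph, with probability greater than $0.99$, it outputs a $(1+\varepsilon)$-approximation to $d$ after at most $C\,\varepsilon^{-2}\sqrt{n/d}\,(\log n)^k$ queries; that is, it makes $\widetilde O(\varepsilon^{-2}\sqrt{n/d})$ queries. (b) Any constant-factor approximation requires $\Omega(\sqrt{n/d})$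 queries, even in the full adjacency model. Precisely: for every $c>1$ there is $\kappa>0$ such that the following holds for every algorithm in the full adjacency model that, on every input graph, outputs a $c$-approximation to the average degree with probability at least $2/3$. For every $n\in\mathbb N$ and every real $d_0$ with $1\le d_0\le n-1$ there is an input graph with exactly $n$ vertices and average degree $d\in[d_0/2,\,2d_0]$ on which, with probability at least $1/4$, the algorithm halts after at least $\kappa\sqrt{n/d}$ queries. -/

import Mathlib

namespace AvgDegree

/-- An input graph: a finite, nonempty, simple undirected graph without isolated vertices. Its
vertices carry distinct identifiers from the infinite universe `ℕ`, and a vertex is identified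
with its identifier; `verts` is an arbitrary finite subset of `ℕ`. -/
structure InputGraph where
  verts : Finset ℕ
  graph : SimpleGraph ℕ
  nonempty : verts.Nonempty
  mem_of_adj : ∀ x y, graph.Adj x y → x ∈ verts
  exists_adj : ∀ x ∈ verts, ∃ y, graph.Adj x y

namespace InputGraph

variable (G : InputGraph)

/-- `n = |V|`. -/
def numVerts : ℕ := G.verts.card

open Classical in
/-- The set of neighbours of `x`. -/
noncomputable def nbrs (x : ℕ) : Finset ℕ := G.verts.filter (fun y => G.graph.Adj x y)

open Classical in
/-- The number of edges of `G` with both endpoints in `S`. -/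
noncomputable def edgesIn (S : Finset ℕ) : ℕ :=
  (S.sym2.filter (fun e => e ∈ G.graph.edgeSet)).card

/-- `m = |E|`. -/
noncomputable def numEdges : ℕ := G.edgesIn G.verts

/-- The average degree `d = 2m/n`. -/
noncomputable def avgDegree : ℝ := 2 * (G.numEdges : ℝ) / (G.numVerts : ℝ)

end InputGraph

/-- The queries: uniform random vertex, uniform random neighbour of a vertex, degree of a vertex,
number of edges inside a vertex set, and the whole neighbourhood of a vertex.
There is no query for a random edge and none for the number of vertices. -/
inductive Query : Type
  | randVert
  | randNbr (x : ℕ)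
  | degree (x : ℕ)
  | additive (S : Finset ℕ)
  | fullNbr (x : ℕ)

/-- The cost of a query: `|S|` for an additive query on `S`, and `1` for any other query. -/
def Query.cost : Query → ℕ
  | .additive S => S.card
  | _ => 1

/-- The vertices that a query mentions. -/
def Query.vertices : Query → Finset ℕ
  | .randVert => ∅
  | .randNbr x => {x}
  | .degree x => {x}
  | .additive S => S
  | .fullNbr x => {x}

/-- The advanced model: random vertices, random neighbours, degrees and additive queries, but no
access to full neighbourhoods. -/
def advancedModel : Set Query := {q | ∀ x, q ≠ Query.fullNbr x}

/-- Answers to queries; `invalid` is the answer to a query that mentions a non-vertex. -/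
inductive Answer : Type
  | vertex (x : ℕ)
  | number (k : ℕ)
  | vertexSet (S : Finset ℕ)
  | invalid

/-- The vertices that an answer reveals. -/
def Answer.vertices : Answer → Finset ℕ
  | .vertex x => {x}
  | .number _ => ∅
  | .vertexSet S => S
  | .invalid => ∅

open Classical in
/-- The distribution of the answer to a query. (In an input graph `nbrs x` is nonempty exactly
when `x` is a vertex.) -/
noncomputable def InputGraph.answer (G : InputGraph) : Query → PMF Answer
  | .randVert => (PMF.uniformOfFinset G.verts G.nonempty).map Answer.vertex
  | .randNbr x =>
      if h : (G.nbrs x).Nonempty then (PMF.uniformOfFinset (G.nbrs x) h).map Answer.vertex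
      else PMF.pure Answer.invalid
  | .degree x =>
      if x ∈ G.verts then PMF.pure (Answer.number (G.nbrs x).card)
      else PMF.pure Answer.invalid
  | .additive S =>
      if S ⊆ G.verts then PMF.pure (Answer.number (G.edgesIn S))
      else PMF.pure Answer.invalid
  | .fullNbr x =>
      if x ∈ G.verts then PMF.pure (Answer.vertexSet (G.nbrs x))
      else PMF.pure Answer.invalid

/-- What an algorithm can do next: halt with a real output, or ask a query and continue in a state
that depends on the answer. -/
inductive Move (σ : Type) : Type
  | output (v : ℝ)
  | ask (q : Query) (next : Answer → σ)

/-- A randomized, adaptive query algorithm, possibly non-terminating: it has a set of internal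
states and in each state chooses its next move at random. It has no input besides the answers to
its queries; in particular it does not know the number of vertices. Any query of `Query` may be
asked, and about any identifier. -/
structure Algorithm where
  State : Type
  init : State
  act : State → PMF (Move State)

namespace Algorithm

variable (A : Algorithm)

/-- The distribution of (output, total cost of the queries) when `A` is started in state `s` and
makes at most `t` moves; `none` if it has not halted by then. -/
noncomputable def outcome (G : InputGraph) : ℕ → A.State → PMF (Option (ℝ × ℕ))
  | 0, _ => PMF.pure none
  | t + 1, s => (A.act s).bind fun mv =>
      match mv with
      | .output v => PMF.pure (some (v, 0))
      | .ask q next => (G.answer q).bind fun a =>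
          (outcome G t (next a)).map (Option.map fun r => (r.1, q.cost + r.2))

/-- The probability that `A`, run on `G`, halts with an output `v` after queries of total cost `q`
such that `E v q` holds (the limit over the number of moves, which is an increasing one). -/
noncomputable def prob (G : InputGraph) (E : ℝ → ℕ → Prop) : ENNReal :=
  ⨆ t : ℕ, (A.outcome G t A.init).toOuterMeasure {o | ∃ v q, o = some (v, q) ∧ E v q}

/-- All queries that `A` can ask belong to `M`. -/
def InModel (M : Set Query) : Prop :=
  ∀ s q next, Move.ask q next ∈ (A.act s).support → q ∈ M

/-- `A.Reachable G s K`: some run of `A` on `G` reaches state `s`, the vertices revealed by the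
answers obtained on the way being those in `K`. -/
inductive Reachable (G : InputGraph) : A.State → Finset ℕ → Prop
  | start : Reachable G A.init ∅
  | step (s : A.State) (K : Finset ℕ) (q : Query) (next : Answer → A.State) (a : Answer) :
      Reachable G s K → Move.ask q next ∈ (A.act s).support → a ∈ (G.answer q).support →
      Reachable G (next a) (K ∪ a.vertices)

/-- On `G`, the algorithm only ever asks about vertices revealed by earlier answers, so it does
not guess identifiers. -/
def OnlyDiscovered (G : InputGraph) : Prop :=
  ∀ s K q next, A.Reachable G s K → Move.ask q next ∈ (A.act s).support → q.vertices ⊆ K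

end Algorithm

/-- `v` is a `c`-approximation to `d`. For `c = 1 + ε` this implies `(1 - ε) d ≤ v ≤ (1 + ε) d`. -/
def IsApprox (c d v : ℝ) : Prop := d / c ≤ v ∧ v ≤ c * d

end AvgDegree

/-! Upper bound. Put θ = √(nd), so that n/θ = √(n/d). Draw a uniform vertex v and a uniform
neighbour u of v, with weight 2 deg v if v precedes u in the order by degree and 0 otherwise. Each
edge is oriented exactly once, so the mean weight is d (`expect_weight`). At most θ neighbours of v
follow it: each of them has degree at least that of v, and all degrees sum to nd = θ²
(`card_out_sq_le`). Hence the second moment is at most 4θd, and by Chebyshev O(ε⁻²√(n/d)) samples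
suffice (`pr_not_isApprox_estimate_le`).

Since n is unknown, the sample size is found by doubling s. `Prog.round` tests whether s² exceeds
n/d in order of magnitude. It succeeds if 2s random vertices span an edge, or if D ≤ W·H, where W is
the total weight of s edge samples, D the largest target degree among them, and H the number of
adjacencies that s random vertices have to that target. Both the number of edges seen and W·H/D have
mean O(s²d/n), so by Markov a small s rarely succeeds (`pr_round_true_le`). For large s, split the
vertices at degree θ. If the edges inside the two sides carry half of the total degree, an edge is
seen, because each vertex has at most θ neighbours on its own side. Otherwise many edges cross, some
sampled target has degree above θ, and the hits on it concentrate (`pr_round_false_le`). The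
probabilities of stopping too early form a geometric series, so `one_le_firstReturn_add` leaves a
small total error.

Lower bound. Let h = ⌊d₀⌋ hubs be adjacent to everything, and plant a clique of about c√(nd)
vertices on one of about √(n/d)/c disjoint blocks; this multiplies the average degree by more than
c². A query of cost q involves at most q blocks, and all other plantings leave its answer
distribution unchanged (`answer_hubClique_eq`). A cheap run on the unplanted graph is therefore a
run on most planted graphs, where its output would be wrong (`payoff_family_le`,
`quarter_le_prob_of_family`). -/

open scoped ENNReal

namespace AvgDegree

/-! ### Expectations of extended nonnegative functions. -/

section Expectation

variable {α β : Type*}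

/-- The expectation of a nonnegative function under a discrete distribution. -/
noncomputable def expect (p : PMF α) (f : α → ℝ≥0∞) : ℝ≥0∞ := ∑' a, p a * f a

theorem expect_pure (a : α) (f : α → ℝ≥0∞) : expect (PMF.pure a) f = f a := by
  unfold expect
  rw [tsum_eq_single a]
  · simp
  · intro b hb; simp [PMF.pure_apply, hb]

theorem expect_bind (p : PMF α) (g : α → PMF β) (f : β → ℝ≥0∞) :
    expect (p.bind g) f = expect p fun a => expect (g a) f := by
  unfold expect
  simp only [PMF.bind_apply, ← ENNReal.tsum_mul_right, ← ENNReal.tsum_mul_left]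
  rw [ENNReal.tsum_comm]
  simp only [mul_assoc]

theorem expect_map (p : PMF α) (g : α → β) (f : β → ℝ≥0∞) :
    expect (p.map g) f = expect p fun a => f (g a) := by
  rw [← PMF.bind_pure_comp, expect_bind]
  simp only [Function.comp, expect_pure]

theorem expect_const (p : PMF α) (c : ℝ≥0∞) : expect p (fun _ => c) = c := by
  unfold expect
  rw [ENNReal.tsum_mul_right, p.tsum_coe, one_mul]

theorem expect_add (p : PMF α) (f g : α → ℝ≥0∞) :
    expect p (fun a => f a + g a) = expect p f + expect p g := by
  unfold expect
  rw [← ENNReal.tsum_add]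
  simp only [mul_add]

theorem expect_const_mul (p : PMF α) (c : ℝ≥0∞) (f : α → ℝ≥0∞) :
    expect p (fun a => c * f a) = c * expect p f := by
  unfold expect
  rw [← ENNReal.tsum_mul_left]
  simp only [mul_left_comm]

theorem expect_mul_const (p : PMF α) (c : ℝ≥0∞) (f : α → ℝ≥0∞) :
    expect p (fun a => f a * c) = expect p f * c := by
  simp only [mul_comm _ c, expect_const_mul]

theorem expect_mono {p : PMF α} {f g : α → ℝ≥0∞} (h : ∀ a, f a ≤ g a) :
    expect p f ≤ expect p g :=
  ENNReal.tsum_le_tsum fun a => by gcongr; exact h a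

theorem expect_mono_of_support {p : PMF α} {f g : α → ℝ≥0∞} (h : ∀ a ∈ p.support, f a ≤ g a) :
    expect p f ≤ expect p g := by
  refine ENNReal.tsum_le_tsum fun a => ?_
  by_cases ha : a ∈ p.support
  · gcongr; exact h a ha
  · rw [PMF.mem_support_iff, not_not] at ha; simp [ha]

theorem expect_congr_of_support {p : PMF α} {f g : α → ℝ≥0∞} (h : ∀ a ∈ p.support, f a = g a) :
    expect p f = expect p g :=
  le_antisymm (expect_mono_of_support fun a ha => (h a ha).le)
    (expect_mono_of_support fun a ha => (h a ha).ge)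

theorem expect_sum {ι : Type*} (p : PMF α) (s : Finset ι) (f : ι → α → ℝ≥0∞) :
    expect p (fun a => ∑ i ∈ s, f i a) = ∑ i ∈ s, expect p (f i) := by
  classical
  induction s using Finset.induction_on with
  | empty => simp [expect_const]
  | insert i s hi ih => simp only [Finset.sum_insert hi, expect_add, ih]

theorem expect_uniformOfFinset (s : Finset α) (hs : s.Nonempty) (f : α → ℝ≥0∞) :
    expect (PMF.uniformOfFinset s hs) f = (∑ a ∈ s, f a) * (s.card : ℝ≥0∞)⁻¹ := by
  unfold expect
  rw [tsum_eq_sum (s := s)]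
  · rw [Finset.sum_mul]
    refine Finset.sum_congr rfl fun a ha => ?_
    rw [PMF.uniformOfFinset_apply_of_mem _ ha, mul_comm]
  · intro a ha; simp [PMF.uniformOfFinset_apply_of_notMem _ ha]

open Classical in
theorem toOuterMeasure_eq_expect (p : PMF α) (S : Set α) :
    p.toOuterMeasure S = expect p fun a => if a ∈ S then 1 else 0 := by
  rw [PMF.toOuterMeasure_apply]
  refine tsum_congr fun a => ?_
  by_cases ha : a ∈ S <;> simp [ha]

end Expectation

/-! ### Expected payoffs of runs of an algorithm. -/

namespace Algorithm

variable (A : Algorithm) (G : InputGraph)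

/-- The expectation of `f output cost` over the runs of at most `t` moves from state `s`; a run
that has not halted contributes `0`. -/
noncomputable def payoff (t : ℕ) (s : A.State) (f : ℝ → ℕ → ℝ≥0∞) : ℝ≥0∞ :=
  expect (A.outcome G t s) fun o => o.elim 0 fun r => f r.1 r.2

theorem payoff_zero (s : A.State) (f : ℝ → ℕ → ℝ≥0∞) : A.payoff G 0 s f = 0 := by
  simp [payoff, outcome, expect_pure]

/-- Conditioning on the first move; the cost already paid is absorbed into the payoff function,
which is why inductions on the number of moves must quantify over `f`. -/
theorem payoff_succ (t : ℕ) (s : A.State) (f : ℝ → ℕ → ℝ≥0∞) :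
    A.payoff G (t + 1) s f = expect (A.act s) fun mv =>
      match mv with
      | .output v => f v 0
      | .ask q next => expect (G.answer q) fun a =>
          A.payoff G t (next a) fun v c => f v (q.cost + c) := by
  simp only [payoff, outcome, expect_bind]
  congr 1
  funext mv
  cases mv with
  | output v => simp [expect_pure]
  | ask q next =>
    simp only [expect_bind, expect_map]
    congr 1
    funext a
    congr 1
    funext o
    cases o <;> simp

theorem payoff_mono {f g : ℝ → ℕ → ℝ≥0∞} (h : ∀ v q, f v q ≤ g v q) (t : ℕ) (s : A.State) :
    A.payoff G t s f ≤ A.payoff G t s g :=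
  expect_mono fun o => by cases o <;> simp [h]

theorem payoff_add (f g : ℝ → ℕ → ℝ≥0∞) (t : ℕ) (s : A.State) :
    A.payoff G t s (fun v q => f v q + g v q) = A.payoff G t s f + A.payoff G t s g := by
  unfold payoff
  rw [← expect_add]
  congr 1
  funext o
  cases o <;> simp

theorem payoff_const_mul (c : ℝ≥0∞) (f : ℝ → ℕ → ℝ≥0∞) (t : ℕ) (s : A.State) :
    A.payoff G t s (fun v q => c * f v q) = c * A.payoff G t s f := by
  unfold payoff
  rw [← expect_const_mul]
  congr 1
  funext o
  cases o <;> simp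

theorem payoff_le_one {f : ℝ → ℕ → ℝ≥0∞} (h : ∀ v q, f v q ≤ 1) (t : ℕ) (s : A.State) :
    A.payoff G t s f ≤ 1 := by
  refine (expect_mono (g := fun _ => 1) fun o => ?_).trans (expect_const _ _).le
  cases o <;> simp [h]

theorem payoff_le_succ (t : ℕ) : ∀ (s : A.State) (f : ℝ → ℕ → ℝ≥0∞),
    A.payoff G t s f ≤ A.payoff G (t + 1) s f := by
  induction t with
  | zero => intro s f; simp [payoff_zero]
  | succ t ih =>
    intro s f
    rw [payoff_succ, payoff_succ A G (t + 1)]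
    refine expect_mono fun mv => ?_
    cases mv with
    | output v => exact le_rfl
    | ask q next => exact expect_mono fun a => ih _ _

theorem payoff_monotone (s : A.State) (f : ℝ → ℕ → ℝ≥0∞) :
    Monotone fun t => A.payoff G t s f :=
  monotone_nat_of_le_succ fun t => A.payoff_le_succ G t s f

open Classical in
theorem prob_eq_iSup_payoff (E : ℝ → ℕ → Prop) :
    A.prob G E = ⨆ t, A.payoff G t A.init fun v q => if E v q then 1 else 0 := by
  unfold prob payoff
  simp only [toOuterMeasure_eq_expect]
  refine iSup_congr fun t => ?_
  congr 1
  funext o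
  cases o with
  | none => simp
  | some r => obtain ⟨v, q⟩ := r; simp

end Algorithm

/-! ### Lower bound: indistinguishable families of graphs. -/

namespace Algorithm

variable (A : Algorithm)

open Classical in
/-- If every query distinguishes few members of a family of graphs from `G₀`, then cheap runs
on `G₀` are also runs on most members of the family. -/
theorem payoff_family_le {ι : Type*} (I : Finset ι) (G₀ : InputGraph) (Gs : ι → InputGraph)
    (h : ∀ q, (I.filter fun i => (Gs i).answer q ≠ G₀.answer q).card ≤ q.cost) (t : ℕ) :
    ∀ J ⊆ I, ∀ (s : A.State) (f : ℝ → ℕ → ℝ≥0∞),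
      A.payoff G₀ t s (fun v q => f v q * ((J.card - q : ℕ) : ℝ≥0∞)) ≤
        ∑ i ∈ J, A.payoff (Gs i) t s f := by
  induction t with
  | zero => intro J _ s f; simp [payoff_zero]
  | succ t ih =>
    intro J hJ s f
    simp only [payoff_succ]
    rw [← expect_sum]
    refine expect_mono fun mv => ?_
    cases mv with
    | output v => simp [mul_comm]
    | ask q next =>
      dsimp only
      -- `J'` holds the members that this query does not separate from `G₀`; at most `q.cost`
      -- members drop out, which the growing subtrahend in the payoff pays for.
      set J' := J.filter fun i => (Gs i).answer q = G₀.answer q with hJ'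
      have hcard : J.card ≤ J'.card + q.cost := by
        rw [hJ', ← Finset.card_filter_add_card_filter_not
          (s := J) (fun i => (Gs i).answer q = G₀.answer q)]
        gcongr
        exact (Finset.card_le_card (Finset.filter_subset_filter _ hJ)).trans (h q)
      have hsub : J' ⊆ J := Finset.filter_subset _ _
      calc _ ≤ expect (G₀.answer q) fun a => ∑ i ∈ J',
            A.payoff (Gs i) t (next a) fun v c => f v (q.cost + c) := by
              refine expect_mono fun a => ?_
              refine le_trans ?_ (ih J' (hsub.trans hJ) (next a) _)
              refine A.payoff_mono G₀ (fun v c => ?_) _ _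
              gcongr f v _ * ?_
              exact_mod_cast (by omega : J.card - (q.cost + c) ≤ J'.card - c)
        _ = ∑ i ∈ J', expect ((Gs i).answer q) fun a =>
              A.payoff (Gs i) t (next a) fun v c => f v (q.cost + c) := by
              rw [expect_sum]
              refine Finset.sum_congr rfl fun i hi => ?_
              rw [(Finset.mem_filter.mp hi).2]
        _ ≤ _ := Finset.sum_le_sum_of_subset hsub

theorem prob_le_add_of_imp (G : InputGraph) {E E₁ E₂ : ℝ → ℕ → Prop}
    (h : ∀ v q, E v q → E₁ v q ∨ E₂ v q) : A.prob G E ≤ A.prob G E₁ + A.prob G E₂ := by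
  classical
  simp only [prob_eq_iSup_payoff]
  refine iSup_le fun t => ?_
  refine le_trans ?_ (add_le_add (le_iSup _ t) (le_iSup _ t))
  rw [← payoff_add]
  refine A.payoff_mono G (fun v q => ?_) _ _
  by_cases hE : E v q
  · rcases h v q hE with h1 | h2
    · simp [hE, h1]
    · simp [hE, h2]
  · simp [hE]

theorem prob_add_le_one (G : InputGraph) {E₁ E₂ : ℝ → ℕ → Prop}
    (h : ∀ v q, E₁ v q → ¬ E₂ v q) : A.prob G E₁ + A.prob G E₂ ≤ 1 := by
  classical
  simp only [prob_eq_iSup_payoff]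
  -- Both payoffs increase with the number of moves, so the sum of the suprema is attained along a
  -- common number of moves.
  rw [ENNReal.iSup_add_iSup_of_monotone (A.payoff_monotone G _ _) (A.payoff_monotone G _ _)]
  refine iSup_le fun t => ?_
  rw [← payoff_add]
  refine A.payoff_le_one G (fun v q => ?_) _ _
  by_cases h1 : E₁ v q
  · simp [h1, h v q h1]
  · by_cases h2 : E₂ v q <;> simp [h1, h2]

open Classical in
/-- An algorithm that is correct on `G₀` and on a family of graphs of much larger average degree
cannot often halt on `G₀` before it could have distinguished `G₀` from most of the family. -/
theorem quarter_le_prob_of_family {ι : Type*} (I : Finset ι) (hI : I.Nonempty)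
    (G₀ : InputGraph) (Gs : ι → InputGraph)
    (h : ∀ q, (I.filter fun i => (Gs i).answer q ≠ G₀.answer q).card ≤ q.cost)
    {c : ℝ} (hc : 0 < c)
    (hA : ∀ G : InputGraph, 2 / 3 ≤ A.prob G (fun v _ => IsApprox c G.avgDegree v))
    (hd : ∀ i ∈ I, c ^ 2 * G₀.avgDegree < (Gs i).avgDegree)
    (T : ℝ) (hT : ∀ q : ℕ, (q : ℝ) < T → 5 * q < I.card) :
    1 / 4 ≤ A.prob G₀ (fun _ q => T ≤ (q : ℝ)) := by
  by_contra hlt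
  rw [not_le] at hlt
  obtain ⟨E, hE⟩ : ∃ E : ℝ → ℕ → Prop, ∀ v q,
      E v q ↔ IsApprox c G₀.avgDegree v ∧ (q : ℝ) < T := ⟨_, fun _ _ => Iff.rfl⟩
  have h1 : 2 / 3 ≤ A.prob G₀ E + A.prob G₀ (fun _ q => T ≤ (q : ℝ)) :=
    (hA G₀).trans (A.prob_le_add_of_imp G₀ fun v q hv => by
      rcases lt_or_ge (q : ℝ) T with hq | hq
      · exact Or.inl ((hE v q).mpr ⟨hv, hq⟩)
      · exact Or.inr hq)
  -- A value within factor c of both averages would force their ratio to be at most c².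
  have h2 : ∀ i ∈ I, A.prob (Gs i) E ≤ 1 / 3 := by
    intro i hi
    have := A.prob_add_le_one (Gs i) (E₁ := fun v _ => IsApprox c (Gs i).avgDegree v) (E₂ := E)
      fun v q hv hv' => by
        have ha := hv.1
        have hb := ((hE v q).mp hv').1.2
        rw [div_le_iff₀ hc] at ha
        have := hd i hi
        nlinarith
    have h3 : 2 / 3 + A.prob (Gs i) E ≤ 2 / 3 + 1 / 3 := by
      refine (add_le_add (hA (Gs i)) le_rfl).trans (this.trans (le_of_eq ?_))
      rw [← ENNReal.add_div]
      norm_num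
      exact (ENNReal.div_self (by norm_num) (by norm_num)).symm
    exact (ENNReal.add_le_add_iff_left (by simp [ENNReal.div_eq_top])).mp h3
  have h3 : A.prob G₀ E ≤ 5 / 12 := by
    rw [prob_eq_iSup_payoff]
    refine iSup_le fun t => ?_
    set p := A.payoff G₀ t A.init fun v q => if E v q then 1 else 0 with hp
    -- If 5q < |I|, at least four fifths of the family survives a run of cost q. Averaging over the
    -- family gives (4/5) p ≤ 1/3, and 2/3 - 5/12 = 1/4 is the probability that remains for long
    -- runs.
    have h4 : (4 * I.card : ℝ≥0∞) * p ≤ 5 * (I.card * (1 / 3)) := by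
      calc _ = A.payoff G₀ t A.init fun v q => (4 * I.card : ℝ≥0∞) * if E v q then 1 else 0 := by
            rw [payoff_const_mul]
        _ ≤ A.payoff G₀ t A.init fun v q =>
              5 * ((if E v q then 1 else 0) * ((I.card - q : ℕ) : ℝ≥0∞)) := by
            refine A.payoff_mono G₀ (fun v q => ?_) _ _
            by_cases hv : E v q
            · have := hT q ((hE v q).mp hv).2
              simp only [hv, if_true, one_mul, mul_one]
              exact_mod_cast (by omega : 4 * I.card ≤ 5 * (I.card - q))
            · simp [hv]
        _ ≤ 5 * ∑ i ∈ I, A.payoff (Gs i) t A.init fun v q => if E v q then 1 else 0 := by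
            rw [payoff_const_mul]
            gcongr
            exact A.payoff_family_le I G₀ Gs h t I subset_rfl _ _
        _ ≤ 5 * ∑ i ∈ I, (1 / 3 : ℝ≥0∞) := by
            gcongr with i hi
            refine le_trans ?_ (h2 i hi)
            rw [prob_eq_iSup_payoff]
            exact le_iSup (fun t => A.payoff (Gs i) t A.init fun v q => if E v q then 1 else 0) t
        _ = _ := by simp
    have hp1 : p ≤ 1 := A.payoff_le_one G₀ (fun v q => by split_ifs <;> simp) _ _
    have hpt : p ≠ ⊤ := ne_top_of_le_ne_top ENNReal.one_ne_top hp1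
    have h5 := ENNReal.toReal_mono (by finiteness) h4
    simp only [ENNReal.toReal_mul, ENNReal.toReal_div, ENNReal.toReal_natCast,
      ENNReal.toReal_ofNat, ENNReal.toReal_one] at h5
    have hpos : (0 : ℝ) < I.card := by exact_mod_cast hI.card_pos
    have h6 : p.toReal ≤ 5 / 12 := by
      by_contra hcon
      rw [not_le] at hcon
      nlinarith
    change p ≤ 5 / 12
    rw [← ENNReal.ofReal_toReal hpt]
    refine (ENNReal.ofReal_le_ofReal h6).trans (le_of_eq ?_)
    rw [ENNReal.ofReal_div_of_pos (by norm_num)]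
    norm_num
  have h4 : (2 / 3 : ℝ≥0∞) < 5 / 12 + 1 / 4 :=
    h1.trans_lt (ENNReal.add_lt_add_of_le_of_lt
      (ne_top_of_le_ne_top (by simp [ENNReal.div_eq_top]) h3) h3 hlt)
  have h5 := (ENNReal.toReal_lt_toReal (by simp [ENNReal.div_eq_top])
    (by simp [ENNReal.div_eq_top])).mpr h4
  rw [ENNReal.toReal_add (by simp [ENNReal.div_eq_top]) (by simp)] at h5
  simp only [ENNReal.toReal_div, ENNReal.toReal_ofNat, ENNReal.toReal_one] at h5
  norm_num at h5

end Algorithm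

/-! ### Edge counts and the hard instances of the lower bound. -/

namespace InputGraph

variable (G : InputGraph)

open Classical in
theorem edgesIn_eq_card_filter_product (S : Finset ℕ) :
    G.edgesIn S = ((S ×ˢ S).filter fun e => e.1 < e.2 ∧ G.graph.Adj e.1 e.2).card := by
  have h := Finset.sum_sym2_filter_not_isDiag S
    fun e => if e ∈ G.graph.edgeSet then 1 else 0
  rw [Finset.sum_ite, Finset.sum_ite] at h
  simp only [Finset.sum_const, smul_eq_mul, mul_one, mul_zero, add_zero, Finset.filter_filter] at h
  rw [edgesIn]
  convert h using 2
  · ext e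
    simp only [Finset.mem_filter]
    refine and_congr_right fun _ => ⟨fun he => ⟨?_, he⟩, fun he => he.2⟩
    exact G.graph.not_isDiag_of_mem_edgeSet he
  · ext ⟨x, y⟩
    simp only [Finset.mem_filter, Finset.mem_product, Finset.mem_offDiag,
      SimpleGraph.mem_edgeSet]
    constructor
    · rintro ⟨⟨hx, hy⟩, hlt, ha⟩
      exact ⟨⟨hx, hy, hlt.ne⟩, hlt, ha⟩
    · rintro ⟨⟨hx, hy, -⟩, hlt, ha⟩
      exact ⟨⟨hx, hy⟩, hlt, ha⟩

open Classical in
theorem two_mul_edgesIn (S : Finset ℕ) :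
    2 * G.edgesIn S = ((S ×ˢ S).filter fun e => G.graph.Adj e.1 e.2).card := by
  rw [two_mul]
  nth_rw 2 [edgesIn_eq_card_filter_product]
  rw [edgesIn_eq_card_filter_product, ← Finset.card_filter_add_card_filter_not
    (s := (S ×ˢ S).filter fun e => G.graph.Adj e.1 e.2) (fun e => e.1 < e.2)]
  simp only [Finset.filter_filter]
  congr 1
  · congr 1; ext e; simp only [Finset.mem_filter]; tauto
  · refine Finset.card_bij (fun e _ => e.swap) ?_ ?_ ?_
    · rintro ⟨x, y⟩ h
      simp only [Finset.mem_filter, Finset.mem_product, Prod.swap] at h ⊢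
      exact ⟨h.1.symm, h.2.2.symm, h.2.1.le.not_gt⟩
    · intro a _ b _ h; exact Prod.swap_injective h
    · rintro ⟨x, y⟩ h
      simp only [Finset.mem_filter, Finset.mem_product] at h
      refine ⟨(y, x), ?_, rfl⟩
      simp only [Finset.mem_filter, Finset.mem_product]
      exact ⟨h.1.symm, lt_of_le_of_ne (not_lt.mp h.2.2) h.2.1.ne', h.2.1.symm⟩

theorem sum_card_nbrs : ∑ x ∈ G.verts, (G.nbrs x).card = 2 * G.numEdges := by
  classical
  rw [numEdges, two_mul_edgesIn, Finset.card_filter, Finset.sum_product]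
  refine Finset.sum_congr rfl fun x _ => ?_
  rw [nbrs, Finset.card_filter]

theorem avgDegree_eq_sum :
    G.avgDegree = (∑ x ∈ G.verts, ((G.nbrs x).card : ℝ)) / G.numVerts := by
  rw [avgDegree, ← Nat.cast_sum, sum_card_nbrs]
  push_cast; rfl

/-- The graph on `{0, …, n - 1}` in which `0, …, h - 1` are adjacent to every other vertex, and
`B` is a clique. -/
def hubClique (n h : ℕ) (B : Finset ℕ) (hn : 2 ≤ n) (hh : 1 ≤ h) : InputGraph where
  verts := Finset.range n
  graph :=
    { Adj := fun x y => x ≠ y ∧ x < n ∧ y < n ∧ (x < h ∨ y < h ∨ (x ∈ B ∧ y ∈ B))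
      symm := ⟨fun x y hxy => ⟨hxy.1.symm, hxy.2.2.1, hxy.2.1, by tauto⟩⟩
      loopless := ⟨fun x hx => hx.1 rfl⟩ }
  nonempty := ⟨0, by simp; omega⟩
  mem_of_adj := fun x y hxy => Finset.mem_range.mpr hxy.2.1
  exists_adj := fun x hx => by
    rw [Finset.mem_range] at hx
    by_cases h0 : x = 0
    · exact ⟨1, by omega, by omega, by omega, by omega⟩
    · exact ⟨0, by omega, by omega, by omega, by omega⟩

variable {n h : ℕ} {B : Finset ℕ} (hn : 2 ≤ n) (hh : 1 ≤ h)

theorem hubClique_nbrs (x : ℕ) :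
    (hubClique n h B hn hh).nbrs x = (Finset.range n).filter fun y =>
      x ≠ y ∧ x < n ∧ y < n ∧ (x < h ∨ y < h ∨ (x ∈ B ∧ y ∈ B)) := by
  classical
  ext y
  simp only [nbrs, Finset.mem_filter]
  rfl

theorem numVerts_hubClique : (hubClique n h B hn hh).numVerts = n := Finset.card_range n

theorem le_avgDegree_hubClique (hB : B ⊆ Finset.range n) :
    (B.card : ℝ) * (B.card - 1) / n ≤ (hubClique n h B hn hh).avgDegree := by
  rw [avgDegree_eq_sum, numVerts_hubClique]
  gcongr
  calc _ = ∑ x ∈ B, ((B.card : ℝ) - 1) := by rw [Finset.sum_const, nsmul_eq_mul]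
    _ ≤ ∑ x ∈ B, (((hubClique n h B hn hh).nbrs x).card : ℝ) := by
        refine Finset.sum_le_sum fun x hx => ?_
        rw [sub_le_iff_le_add]
        have : B.card - 1 ≤ ((hubClique n h B hn hh).nbrs x).card := by
          rw [← Finset.card_erase_of_mem hx]
          refine Finset.card_le_card fun y hy => ?_
          rw [Finset.mem_erase] at hy
          have hy' := Finset.mem_range.mp (hB hy.2)
          have hx' := Finset.mem_range.mp (hB hx)
          rw [hubClique_nbrs, Finset.mem_filter, Finset.mem_range]
          exact ⟨hy', hy.1.symm, hx', hy', Or.inr (Or.inr ⟨hx, hy.2⟩)⟩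
        exact_mod_cast (by omega : B.card ≤ ((hubClique n h B hn hh).nbrs x).card + 1)
    _ ≤ _ := Finset.sum_le_sum_of_subset_of_nonneg hB fun _ _ _ => by positivity

/-- The degrees sum to h(n - 1) + (n - h)h, which lies between hn and 2hn. -/
theorem avgDegree_hubClique_empty_bounds (hhn : h + 1 ≤ n) :
    (h : ℝ) ≤ (hubClique n h ∅ hn hh).avgDegree ∧
      (hubClique n h ∅ hn hh).avgDegree ≤ 2 * h := by
  have hn0 : (0 : ℝ) < n := by exact_mod_cast (by omega : 0 < n)
  have hcard : ∀ x ∈ Finset.range n, ((hubClique n h ∅ hn hh).nbrs x).card =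
      if x < h then n - 1 else h := by
    intro x hx
    have hx' := Finset.mem_range.mp hx
    rw [hubClique_nbrs]
    split_ifs with hxh
    · rw [← Finset.card_range n, ← Finset.card_erase_of_mem hx, Finset.card_range]
      congr 1
      ext y
      simp only [Finset.mem_filter, Finset.mem_erase, Finset.mem_range]
      omega
    · conv_rhs => rw [← Finset.card_range h]
      congr 1
      ext y
      simp only [Finset.mem_filter, Finset.mem_range, Finset.notMem_empty, and_self, or_false]
      omega
  rw [avgDegree_eq_sum, numVerts_hubClique, le_div_iff₀ hn0, div_le_iff₀ hn0]
  change (h : ℝ) * n ≤ ∑ x ∈ Finset.range n, _ ∧ ∑ x ∈ Finset.range n, _ ≤ 2 * (h : ℝ) * n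
  rw [← Nat.cast_sum, Finset.sum_congr rfl hcard]
  constructor
  · have : ∑ x ∈ Finset.range n, h ≤ ∑ x ∈ Finset.range n, if x < h then n - 1 else h := by
      refine Finset.sum_le_sum fun x _ => ?_
      split_ifs <;> omega
    rw [Finset.sum_const, Finset.card_range, smul_eq_mul] at this
    rw [mul_comm (h : ℝ)]
    exact_mod_cast this
  · have h1 : ∑ x ∈ Finset.range n, (if x < h then n - 1 else h) ≤
        ∑ x ∈ Finset.range n, ((if x < h then n else 0) + h) := by
      refine Finset.sum_le_sum fun x _ => ?_
      split_ifs <;> omega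
    have h2 : (Finset.range n).filter (· < h) = Finset.range h := by
      ext x; simp only [Finset.mem_filter, Finset.mem_range]; omega
    rw [Finset.sum_add_distrib, ← Finset.sum_filter, h2] at h1
    simp only [Finset.sum_const, Finset.card_range, smul_eq_mul] at h1
    calc _ ≤ ((h * n + n * h : ℕ) : ℝ) := by exact_mod_cast h1
      _ = _ := by push_cast; ring

/-- The clique changes only the neighbourhoods of vertices of `B` and the pairs inside `B`. Random
vertices may fall into `B`, but the vertex set, and so this answer, does not depend on `B`. -/
theorem answer_hubClique_eq (q : Query) (hq : ∀ x ∈ q.vertices, x ∉ B) :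
    (hubClique n h B hn hh).answer q = (hubClique n h ∅ hn hh).answer q := by
  have hnb : ∀ x ∉ B, (hubClique n h B hn hh).nbrs x = (hubClique n h ∅ hn hh).nbrs x := by
    intro x hx
    simp only [hubClique_nbrs, hx, false_and, Finset.notMem_empty]
  cases q with
  | randVert => rfl
  | randNbr x => simp only [answer, hnb x (hq x (by simp [Query.vertices]))]
  | degree x =>
    simp only [answer, hnb x (hq x (by simp [Query.vertices]))]
    rfl
  | fullNbr x =>
    simp only [answer, hnb x (hq x (by simp [Query.vertices]))]
    rfl
  | additive S =>
    have : (hubClique n h B hn hh).edgesIn S = (hubClique n h ∅ hn hh).edgesIn S := by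
      classical
      simp only [edgesIn_eq_card_filter_product]
      congr 1
      refine Finset.filter_congr ?_
      rintro ⟨x, y⟩ hxy
      have hx : x ∉ B := hq x (Finset.mem_product.mp hxy).1
      change _ ∧ (_ ∧ _ ∧ _ ∧ (_ ∨ _ ∨ (x ∈ B ∧ _))) ↔ _ ∧ (_ ∧ _ ∧ _ ∧ (_ ∨ _ ∨ (x ∈ _ ∧ _)))
      simp only [hx, false_and, Finset.notMem_empty]
    simp only [answer, this]
    rfl

end InputGraph

/-! ### The lower bound on the number of queries. -/

theorem Query.card_vertices_le_cost (q : Query) : q.vertices.card ≤ q.cost := by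
  cases q <;> simp [Query.vertices, Query.cost]

theorem Query.eq_additive_empty_of_cost_eq_zero {q : Query} (h : q.cost = 0) :
    q = .additive ∅ := by
  cases q <;> simp_all [Query.cost]

open InputGraph in
theorem exists_graph_with_many_queries {c : ℝ} (hc : 1 < c) (A : Algorithm)
    (hA : ∀ G : InputGraph, 2 / 3 ≤ A.prob G (fun v _ => IsApprox c G.avgDegree v))
    (n : ℕ) (d : ℝ) (hd : 1 ≤ d) (hdn : d ≤ (n : ℝ) - 1) :
    ∃ G : InputGraph, G.numVerts = n ∧ d / 2 ≤ G.avgDegree ∧ G.avgDegree ≤ 2 * d ∧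
      1 / 4 ≤ A.prob G (fun _ q =>
        1 / (20 * (c + 2)) * Real.sqrt ((G.numVerts : ℝ) / G.avgDegree) ≤ (q : ℝ)) := by
  classical
  have hn : 2 ≤ n := by
    have : (2 : ℝ) ≤ n := by linarith
    exact_mod_cast this
  -- As d ≥ 1, h ≤ d < h + 1 ≤ 2h, so an average degree in [h, 2h] lies in [d/2, 2d].
  set h := ⌊d⌋₊ with hhdef
  have hh : 1 ≤ h := Nat.le_floor (by exact_mod_cast hd)
  have hle : (h : ℝ) ≤ d := Nat.floor_le (by linarith)
  have hlt : d < h + 1 := Nat.lt_floor_add_one d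
  have hh' : (1 : ℝ) ≤ h := by exact_mod_cast hh
  have hhn : h + 1 ≤ n := by
    have : (h : ℝ) + 1 ≤ n := by linarith
    exact_mod_cast this
  obtain ⟨hlo, hhi⟩ := avgDegree_hubClique_empty_bounds hn hh hhn
  refine ⟨hubClique n h ∅ hn hh, numVerts_hubClique hn hh, by linarith, by linarith, ?_⟩
  set d₀ := (hubClique n h ∅ hn hh).avgDegree with hd₀
  rw [numVerts_hubClique]
  have hd₀1 : 1 ≤ d₀ := hh'.trans hlo
  have hn0 : (2 : ℝ) ≤ n := by exact_mod_cast hn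
  set a := Real.sqrt (n * d₀) with ha
  have ha2 : a ^ 2 = n * d₀ := Real.sq_sqrt (by positivity)
  have ha1 : 1 ≤ a := Real.one_le_sqrt.mpr (by nlinarith)
  have hquot : Real.sqrt (n / d₀) = n / a := by
    rw [eq_div_iff (by positivity), ha, ← Real.sqrt_mul (by positivity)]
    rw [show (n / d₀ * (n * d₀) : ℝ) = n ^ 2 by field_simp]
    exact Real.sqrt_sq (by positivity)
  rw [hquot]
  -- The clique size: k - 1 ≥ ca gives k(k - 1) > c²nd₀, and a ≥ 1 keeps k within (c + 2)a.
  set k := ⌈c * a⌉₊ + 1 with hk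
  have hk1 : c * a + 1 ≤ k := by
    rw [hk]; push_cast
    linarith [Nat.le_ceil (c * a)]
  have hk2 : (k : ℝ) ≤ (c + 2) * a := by
    rw [hk]; push_cast
    nlinarith [Nat.ceil_lt_add_one (show 0 ≤ c * a by positivity)]
  have hk0 : 0 < k := by omega
  have hkbig : c ^ 2 * (n * d₀) < (k : ℝ) * (k - 1) := by
    rw [← ha2]
    have : 0 < c * a := by positivity
    nlinarith
  -- If a clique of size k fits, the family consists of the plantings on the ⌊n/k⌋ disjoint blocks
  -- of k consecutive identifiers.
  by_cases hkn : k ≤ n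
  · have hblock : ∀ i ∈ Finset.range (n / k),
        Finset.Ico (i * k) (i * k + k) ⊆ Finset.range n := by
      intro i hi x hx
      rw [Finset.mem_range] at hi ⊢
      rw [Finset.mem_Ico] at hx
      have : (i + 1) * k ≤ n := (Nat.mul_le_mul_right k hi).trans (Nat.div_mul_le_self n k)
      nlinarith
    have hr : 1 ≤ n / k := Nat.div_pos hkn hk0
    refine A.quarter_le_prob_of_family (Finset.range (n / k)) ⟨0, by simpa using ⟨hk0, hkn⟩⟩ _
      (fun i => hubClique n h (Finset.Ico (i * k) (i * k + k)) hn hh) ?_ (by linarith) hA ?_ _ ?_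
    · intro q
      refine le_trans ?_ q.card_vertices_le_cost
      -- Division by k sends a vertex to the index of its block, so the separated plantings are
      -- among the images of the queried vertices.
      refine le_trans (Finset.card_le_card fun i hi => ?_)
        (Finset.card_image_le (s := q.vertices) (f := (· / k)))
      rw [Finset.mem_filter] at hi
      by_contra hcon
      refine hi.2 (answer_hubClique_eq hn hh q fun x hx hxB => hcon ?_)
      rw [Finset.mem_image]
      refine ⟨x, hx, ?_⟩
      rw [Finset.mem_Ico] at hxB
      exact Nat.div_eq_of_lt_le (by linarith) (by linarith)
    · intro i hi
      refine lt_of_lt_of_le ?_ (le_avgDegree_hubClique hn hh (hblock i hi))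
      rw [lt_div_iff₀ (by positivity), Nat.card_Ico, Nat.add_sub_cancel_left]
      linarith
    · intro q hq
      rw [Finset.card_range]
      -- Rounding n/k down loses at most a factor 2 because n/k ≥ 1. This and k ≤ (c + 2)a account
      -- for the constant 1/(20(c + 2)).
      have h1 : (n : ℝ) < (2 * (n / k : ℕ) : ℝ) * k := by
        have h2 : n < (n / k + 1) * k := by
          rw [mul_comm]; exact Nat.lt_mul_div_succ n hk0
        have h3 : n < 2 * (n / k) * k := by nlinarith
        exact_mod_cast h3
      have h2 : (n : ℝ) / a ≤ 2 * (n / k : ℕ) * (c + 2) := by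
        rw [div_le_iff₀ (by positivity)]
        nlinarith [Nat.cast_nonneg (α := ℝ) (n / k)]
      have h3 : (q : ℝ) * (20 * (c + 2)) < n / a := by
        rw [one_div_mul_eq_div, lt_div_iff₀ (by positivity)] at hq
        exact hq
      have h4 : (10 * q : ℝ) < (n / k : ℕ) := by nlinarith
      have h5 : 10 * q < n / k := by exact_mod_cast h4
      omega
  -- Here the claimed bound is below 1, so only runs of cost 0 must be excluded. The sole free query
  -- is the additive one on ∅, which answers 0 on every graph; hence one complete graph on N
  -- vertices, N unrelated to n, suffices as the family.
  · rw [not_le] at hkn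
    set N := ⌈c ^ 2 * d₀⌉₊ + 2 with hN
    have hNbig : c ^ 2 * d₀ < (N : ℝ) - 1 := by
      rw [hN]; push_cast
      linarith [Nat.le_ceil (c ^ 2 * d₀)]
    refine A.quarter_le_prob_of_family {()} ⟨(), by simp⟩ _
      (fun _ => hubClique N 1 (Finset.range N) (by omega) le_rfl) ?_ (by linarith) hA ?_ _ ?_
    · intro q
      by_cases hq : q.cost = 0
      · rw [Query.eq_additive_empty_of_cost_eq_zero hq]
        simp [answer, edgesIn, Query.cost]
      · refine (Finset.card_filter_le _ _).trans ?_
        rw [Finset.card_singleton]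
        omega
    · intro i _
      refine lt_of_lt_of_le hNbig ?_
      refine le_trans (le_of_eq ?_) (le_avgDegree_hubClique (by omega) le_rfl subset_rfl)
      have : (N : ℝ) ≠ 0 := by rw [hN]; positivity
      rw [Finset.card_range]
      field_simp
    · intro q hq
      have hnk : (n : ℝ) < k := by exact_mod_cast hkn
      have h1 : (n : ℝ) / a < c + 2 := by
        rw [div_lt_iff₀ (by positivity)]; linarith
      rw [one_div_mul_eq_div, lt_div_iff₀ (by positivity)] at hq
      have h2 : (q : ℝ) < 1 := by nlinarith [Nat.cast_nonneg (α := ℝ) q]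
      have h3 : q < 1 := by exact_mod_cast h2
      simp; omega

/-! ### Markov, Chebyshev and independent samples. -/

section Probability

variable {α β : Type*}

open Classical in
/-- The probability of an event under a discrete distribution. -/
noncomputable def pr (p : PMF α) (E : α → Prop) : ℝ≥0∞ := expect p fun a => if E a then 1 else 0

theorem pr_eq_expect (p : PMF α) (E : α → Prop) [DecidablePred E] :
    pr p E = expect p fun a => if E a then 1 else 0 := by
  rw [pr]
  congr!

theorem expect_comm (p : PMF α) (q : PMF β) (f : α → β → ℝ≥0∞) :
    (expect p fun a => expect q fun b => f a b) = expect q fun b => expect p fun a => f a b := by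
  unfold expect
  simp only [← ENNReal.tsum_mul_left]
  rw [ENNReal.tsum_comm]
  simp only [mul_left_comm]

theorem pr_bind (p : PMF α) (g : α → PMF β) (E : β → Prop) :
    pr (p.bind g) E = expect p fun a => pr (g a) E := expect_bind _ _ _

theorem pr_mono {p : PMF α} {E F : α → Prop} (h : ∀ a ∈ p.support, E a → F a) :
    pr p E ≤ pr p F := by
  refine expect_mono_of_support fun a ha => ?_
  by_cases hE : E a
  · simp [hE, h a ha hE]
  · simp [hE]

theorem pr_le_one (p : PMF α) (E : α → Prop) : pr p E ≤ 1 := by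
  refine (expect_mono (g := fun _ => 1) fun a => ?_).trans (expect_const p 1).le
  split_ifs <;> simp

theorem pr_add_pr_not (p : PMF α) (E : α → Prop) : pr p E + pr p (fun a => ¬ E a) = 1 := by
  unfold pr
  rw [← expect_add]
  refine Eq.trans ?_ (expect_const p 1)
  congr 1
  funext a
  by_cases hE : E a <;> simp [hE]

/-- Markov's inequality. -/
theorem mul_pr_le_expect (p : PMF α) {E : α → Prop} {f : α → ℝ≥0∞} {c : ℝ≥0∞}
    (h : ∀ a ∈ p.support, E a → c ≤ f a) : c * pr p E ≤ expect p f := by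
  unfold pr
  rw [← expect_const_mul]
  refine expect_mono_of_support fun a ha => ?_
  by_cases hE : E a
  · simpa [hE] using h a ha hE
  · simp [hE]

/-- Chebyshev's inequality. -/
theorem mul_pr_le_of_second_moment (p : PMF α) (Y : α → ℕ) {μ V r : ℝ} (hμ : 0 ≤ μ)
    (hV : 0 ≤ V) (h1 : expect p (fun a => (Y a : ℝ≥0∞)) = ENNReal.ofReal μ)
    (h2 : expect p (fun a => (Y a : ℝ≥0∞) ^ 2) ≤ ENNReal.ofReal (μ ^ 2 + V)) :
    ENNReal.ofReal (r ^ 2) * pr p (fun a => r ^ 2 ≤ ((Y a : ℝ) - μ) ^ 2) ≤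
      ENNReal.ofReal V := by
  -- The square is expanded with the mixed term moved to the left, since subtraction of extended
  -- nonnegative reals truncates.
  have key : ∀ a, ENNReal.ofReal (((Y a : ℝ) - μ) ^ 2) + ENNReal.ofReal (2 * μ) * (Y a : ℝ≥0∞) =
      (Y a : ℝ≥0∞) ^ 2 + ENNReal.ofReal (μ ^ 2) := by
    intro a
    rw [← ENNReal.ofReal_natCast, ← ENNReal.ofReal_mul (by positivity),
      ← ENNReal.ofReal_pow (by positivity), ← ENNReal.ofReal_add (by positivity) (by positivity),
      ← ENNReal.ofReal_add (by positivity) (by positivity)]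
    congr 1; ring
  have h3 : expect p (fun a => ENNReal.ofReal (((Y a : ℝ) - μ) ^ 2)) +
      ENNReal.ofReal (2 * μ) * ENNReal.ofReal μ ≤
        ENNReal.ofReal V + ENNReal.ofReal (2 * μ) * ENNReal.ofReal μ := by
    nth_rw 1 [← h1]
    rw [← expect_const_mul, ← expect_add]
    simp only [key]
    rw [expect_add, expect_const]
    refine (add_le_add h2 le_rfl).trans (le_of_eq ?_)
    rw [← ENNReal.ofReal_mul (by positivity), ← ENNReal.ofReal_add (by positivity) (by positivity),
      ← ENNReal.ofReal_add (by positivity) (by positivity)]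
    congr 1; ring
  refine le_trans (mul_pr_le_expect p fun a _ ha => ?_)
    ((ENNReal.add_le_add_iff_right (by finiteness)).mp h3)
  exact ENNReal.ofReal_le_ofReal ha

theorem pr_le_ofReal_div {p : PMF α} {E : α → Prop} {c v : ℝ} (hc : 0 < c)
    (h : ENNReal.ofReal c * pr p E ≤ ENNReal.ofReal v) : pr p E ≤ ENNReal.ofReal (v / c) := by
  rw [ENNReal.ofReal_div_of_pos hc, ENNReal.le_div_iff_mul_le (by simp [hc]) (by simp), mul_comm]
  exact h

/-- The distribution of a list of `N` independent samples. -/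
noncomputable def iid (p : PMF α) : ℕ → PMF (List α)
  | 0 => PMF.pure []
  | N + 1 => p.bind fun a => (iid p N).bind fun l => PMF.pure (a :: l)

theorem expect_iid_succ (p : PMF α) (N : ℕ) (f : List α → ℝ≥0∞) :
    expect (iid p (N + 1)) f = expect p fun a => expect (iid p N) fun l => f (a :: l) := by
  simp only [iid, expect_bind, expect_pure]

theorem expect_iid_sum (p : PMF α) (f : α → ℝ≥0∞) (N : ℕ) :
    (expect (iid p N) fun l => (l.map f).sum) = N * expect p f := by
  induction N with
  | zero => simp [iid, expect_pure]
  | succ N ih =>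
    simp only [expect_iid_succ, List.map_cons, List.sum_cons, expect_add, expect_const, ih]
    push_cast; ring

/-- The N diagonal pairs contribute the first term, and the N(N - 1) pairs of distinct positions are
independent; their number is rounded up to N². -/
theorem expect_iid_sum_sum_le (p : PMF α) (f : α → α → ℝ≥0∞) (N : ℕ) :
    (expect (iid p N) fun l => (l.map fun x => (l.map fun y => f x y).sum).sum) ≤
      N * expect p (fun x => f x x) +
        (N : ℝ≥0∞) ^ 2 * expect p fun x => expect p fun y => f x y := by
  induction N with
  | zero => simp [iid, expect_pure]
  | succ N ih =>
    simp only [expect_iid_succ, List.map_cons, List.sum_cons, List.sum_map_add, expect_add,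
      expect_const, expect_iid_sum]
    have hcomm := expect_comm p p fun a b => f b a
    rw [expect_const_mul, expect_const_mul, hcomm]
    set u := expect p fun x => f x x
    set v := expect p fun x => expect p fun y => f x y
    calc _ ≤ u + N * v + (N * v + (N * u + (N : ℝ≥0∞) ^ 2 * v)) := by gcongr
      -- The extra `v` completes N² + 2N to (N + 1)².
      _ ≤ u + N * v + (N * v + (N * u + (N : ℝ≥0∞) ^ 2 * v)) + v := le_self_add
      _ = _ := by push_cast; ring

theorem expect_iid_sum_sq_le (p : PMF α) (f : α → ℝ≥0∞) (N : ℕ) :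
    (expect (iid p N) fun l => (l.map f).sum ^ 2) ≤
      N * expect p (fun x => f x ^ 2) + (N * expect p f) ^ 2 := by
  have h := expect_iid_sum_sum_le p (fun x y => f x * f y) N
  simp only [List.sum_map_mul_left, List.sum_map_mul_right, expect_const_mul, expect_mul_const,
    ← sq] at h
  rwa [mul_pow]

theorem natCast_sum_map (l : List α) (f : α → ℕ) :
    (((l.map f).sum : ℕ) : ℝ≥0∞) = (l.map fun a => (f a : ℝ≥0∞)).sum := by
  induction l with
  | nil => simp
  | cons a l ih => simp [ih]

/-- Chebyshev's inequality for a sum of independent samples. -/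
theorem pr_iid_sum_le (p : PMF α) (f : α → ℕ) (N : ℕ) {μ V r : ℝ} (hμ : 0 ≤ μ) (hV : 0 ≤ V)
    (hr : 0 < r) (h1 : expect p (fun a => (f a : ℝ≥0∞)) = ENNReal.ofReal μ)
    (h2 : expect p (fun a => (f a : ℝ≥0∞) ^ 2) ≤ ENNReal.ofReal V) :
    pr (iid p N) (fun l => r ^ 2 ≤ (((l.map f).sum : ℕ) - N * μ : ℝ) ^ 2) ≤
      ENNReal.ofReal (N * V / r ^ 2) := by
  refine pr_le_ofReal_div (by positivity) ?_
  refine mul_pr_le_of_second_moment (iid p N) (fun l => (l.map f).sum) (by positivity)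
    (by positivity) ?_ ?_
  · simp only [natCast_sum_map, expect_iid_sum, h1]
    rw [ENNReal.ofReal_mul (by positivity), ENNReal.ofReal_natCast]
  · simp only [natCast_sum_map]
    refine (expect_iid_sum_sq_le p _ N).trans ?_
    rw [h1, add_comm, ENNReal.ofReal_add (by positivity) (by positivity), ENNReal.ofReal_pow
      (by positivity), ENNReal.ofReal_mul (by positivity), ENNReal.ofReal_mul (by positivity),
      ENNReal.ofReal_natCast]
    gcongr

end Probability

/-! ### Query programs, their distributions and their costs. -/

/-- Terminating query programs of the advanced model that use no randomness of their own. -/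
inductive Prog (α : Type) : Type
  | ret (a : α)
  | ask (q : Query) (hq : q ∈ advancedModel) (next : Answer → Prog α)

namespace Prog

variable {α β : Type}

/-- Sequential composition. -/
def bind : Prog α → (α → Prog β) → Prog β
  | ret a, f => f a
  | ask q hq next, f => ask q hq fun a => (next a).bind f

/-- The distribution of the result of a program. -/
noncomputable def dist (G : InputGraph) : Prog α → PMF α
  | ret a => PMF.pure a
  | ask q _ next => (G.answer q).bind fun a => (next a).dist G

/-- Along every run on `G` that starts with known vertices `K`, only known vertices are asked
about, the number of queries plus their cost is at most `c`, and `Q` holds for the result and the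
vertices then known. -/
def Safe (G : InputGraph) (Q : α → Finset ℕ → Prop) : Prog α → Finset ℕ → ℕ → Prop
  | ret a, K, _ => Q a K
  | ask q _ next, K, c => q.vertices ⊆ K ∧ q.cost + 1 ≤ c ∧
      ∀ a ∈ (G.answer q).support, (next a).Safe G Q (K ∪ a.vertices) (c - (q.cost + 1))

/-- The list of results of `N` independent runs. -/
def replicate (p : Prog α) : ℕ → Prog (List α)
  | 0 => ret []
  | N + 1 => p.bind fun a => (replicate p N).bind fun l => ret (a :: l)

variable {G : InputGraph}

theorem dist_bind (p : Prog α) (f : α → Prog β) :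
    (p.bind f).dist G = (p.dist G).bind fun a => (f a).dist G := by
  induction p with
  | ret a => simp [bind, dist, PMF.pure_bind]
  | ask q hq next ih => simp [bind, dist, PMF.bind_bind, ih]

theorem dist_replicate (p : Prog α) (N : ℕ) : (p.replicate N).dist G = iid (p.dist G) N := by
  induction N with
  | zero => rfl
  | succ N ih => simp only [replicate, dist_bind, ih, iid, dist]

theorem Safe.mono {Q R : α → Finset ℕ → Prop} (h : ∀ a K, Q a K → R a K) {p : Prog α} :
    ∀ {K : Finset ℕ} {c c' : ℕ}, c ≤ c' → p.Safe G Q K c → p.Safe G R K c' := by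
  induction p with
  | ret a => intro K c c' _ hp; exact h _ _ hp
  | ask q hq next ih =>
    intro K c c' hc hp
    exact ⟨hp.1, hp.2.1.trans hc, fun a ha => ih a (by omega) (hp.2.2 a ha)⟩

theorem Safe.bind {Q : α → Finset ℕ → Prop} {R : β → Finset ℕ → Prop} {p : Prog α}
    {f : α → Prog β} {c' : ℕ} (hf : ∀ a K, Q a K → (f a).Safe G R K c') :
    ∀ {K : Finset ℕ} {c : ℕ}, p.Safe G Q K c → (p.bind f).Safe G R K (c + c') := by
  induction p with
  | ret a =>
    intro K c hp
    exact Safe.mono (fun _ _ h => h) (by omega) (hf _ _ hp)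
  | ask q hq next ih =>
    intro K c hp
    refine ⟨hp.1, by have := hp.2.1; omega, fun a ha => ?_⟩
    have h := ih a (hp.2.2 a ha)
    have hc := hp.2.1
    rwa [← Nat.sub_add_comm hc] at h

/-- `V a` stands for the vertices that a result guarantees to be known. Known sets only grow, so
after all runs they contain `V a` for every result `a`. -/
theorem Safe.replicate {p : Prog α} {V : α → Finset ℕ} {c : ℕ} {K₀ : Finset ℕ}
    (hp : ∀ K, K₀ ⊆ K → p.Safe G (fun a K' => K ⊆ K' ∧ V a ⊆ K') K c) (N : ℕ) :
    ∀ K, K₀ ⊆ K →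
      (p.replicate N).Safe G (fun l K' => l.length = N ∧ K ⊆ K' ∧ ∀ a ∈ l, V a ⊆ K') K
        (N * c) := by
  induction N with
  | zero => intro K _; exact ⟨rfl, subset_rfl, by simp⟩
  | succ N ih =>
    intro K hK
    rw [Nat.succ_mul, add_comm (N * c)]
    refine Safe.bind (fun a K₁ h₁ => ?_) (hp K hK)
    refine Safe.mono (c := N * c + 0) (fun _ _ h => h) le_rfl ?_
    refine Safe.bind (fun l K₂ h₂ => ?_) (ih K₁ (hK.trans h₁.1))
    refine ⟨by simp [h₂.1], h₁.1.trans h₂.2.1, fun b hb => ?_⟩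
    rcases List.mem_cons.mp hb with rfl | hb
    · exact h₁.2.trans h₂.2.1
    · exact h₂.2.2 b hb

/-- A uniformly random vertex. -/
def randVert : Prog ℕ :=
  ask .randVert (by simp [advancedModel]) fun
    | .vertex x => ret x
    | _ => ret 0

/-- A uniformly random neighbour. -/
def randNbr (x : ℕ) : Prog ℕ :=
  ask (.randNbr x) (by simp [advancedModel]) fun
    | .vertex x => ret x
    | _ => ret 0

/-- The degree of a vertex. -/
def degree (x : ℕ) : Prog ℕ :=
  ask (.degree x) (by simp [advancedModel]) fun
    | .number k => ret k
    | _ => ret 0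

/-- The number of edges inside a set. -/
def edgesIn (S : Finset ℕ) : Prog ℕ :=
  ask (.additive S) (by simp [advancedModel]) fun
    | .number k => ret k
    | _ => ret 0

theorem nbrs_nonempty {x : ℕ} (hx : x ∈ G.verts) : (G.nbrs x).Nonempty := by
  obtain ⟨y, hy⟩ := G.exists_adj x hx
  classical
  exact ⟨y, by
    rw [InputGraph.nbrs, Finset.mem_filter]
    exact ⟨G.mem_of_adj y x hy.symm, hy⟩⟩

theorem dist_randVert : randVert.dist G = PMF.uniformOfFinset G.verts G.nonempty := by
  simp only [randVert, dist, InputGraph.answer, ← PMF.bind_pure_comp, PMF.bind_bind,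
    Function.comp, PMF.pure_bind, PMF.bind_pure]

theorem dist_randNbr {x : ℕ} (hx : x ∈ G.verts) :
    (randNbr x).dist G = PMF.uniformOfFinset (G.nbrs x) (nbrs_nonempty hx) := by
  simp only [randNbr, dist, InputGraph.answer, nbrs_nonempty hx, dif_pos, ← PMF.bind_pure_comp,
    PMF.bind_bind, Function.comp, PMF.pure_bind, PMF.bind_pure]

theorem dist_degree {x : ℕ} (hx : x ∈ G.verts) :
    (degree x).dist G = PMF.pure (G.nbrs x).card := by
  simp only [degree, dist, InputGraph.answer, hx, if_pos, PMF.pure_bind]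

theorem dist_edgesIn {S : Finset ℕ} (hS : S ⊆ G.verts) :
    (edgesIn S).dist G = PMF.pure (G.edgesIn S) := by
  simp only [edgesIn, dist, InputGraph.answer, hS, if_pos, PMF.pure_bind]

theorem safe_randVert (K : Finset ℕ) :
    randVert.Safe G (fun x K' => x ∈ G.verts ∧ K ⊆ K' ∧ {x} ⊆ K') K 2 := by
  refine ⟨by simp [Query.vertices], by simp [Query.cost], fun a ha => ?_⟩
  rw [InputGraph.answer, PMF.mem_support_map_iff] at ha
  obtain ⟨x, hx, rfl⟩ := ha
  rw [PMF.mem_support_uniformOfFinset_iff] at hx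
  exact ⟨hx, Finset.subset_union_left, Finset.subset_union_right⟩

theorem safe_randNbr {x : ℕ} {K : Finset ℕ} (hx : x ∈ K) (hxG : x ∈ G.verts) :
    (randNbr x).Safe G (fun x K' => K ⊆ K' ∧ {x} ⊆ K') K 2 := by
  refine ⟨by simpa [Query.vertices] using hx, by simp [Query.cost], fun a ha => ?_⟩
  rw [InputGraph.answer, dif_pos (nbrs_nonempty hxG), PMF.mem_support_map_iff] at ha
  obtain ⟨x, -, rfl⟩ := ha
  exact ⟨Finset.subset_union_left, Finset.subset_union_right⟩

theorem safe_degree {x : ℕ} {K : Finset ℕ} (hx : x ∈ K) :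
    (degree x).Safe G (fun _ K' => K ⊆ K') K 2 := by
  refine ⟨by simpa [Query.vertices] using hx, by simp [Query.cost], fun a ha => ?_⟩
  cases a <;> exact Finset.subset_union_left

theorem safe_edgesIn {S K : Finset ℕ} (hS : S ⊆ K) :
    (edgesIn S).Safe G (fun _ K' => K ⊆ K') K (S.card + 1) := by
  refine ⟨by simpa [Query.vertices] using hS, by simp [Query.cost], fun a ha => ?_⟩
  cases a <;> exact Finset.subset_union_left

end Prog

/-! ### Running programs in a loop until one returns a number. -/

/-- The algorithm that runs `body 0`, `body 1`, … until one of these programs returns a number. -/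
noncomputable def loop (body : ℕ → Prog (Option ℝ)) : Algorithm where
  State := ℕ × Prog (Option ℝ)
  init := (0, body 0)
  act
    | (_, .ret (some v)) => PMF.pure (.output v)
    | (j, .ret none) => PMF.pure (.ask .randVert fun _ => (j + 1, body (j + 1)))
    | (j, .ask q _ next) => PMF.pure (.ask q fun a => (j, next a))

section Loop

variable (body : ℕ → Prog (Option ℝ)) {G : InputGraph}

/-- The state of `loop body` in which the program `p` remains of `body j`. -/
def loopState (j : ℕ) (p : Prog (Option ℝ)) : (loop body).State := (j, p)

theorem act_loopState_ret_some (j : ℕ) (v : ℝ) :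
    (loop body).act (loopState body j (.ret (some v))) = PMF.pure (.output v) := rfl

theorem act_loopState_ret_none (j : ℕ) :
    (loop body).act (loopState body j (.ret none)) =
      PMF.pure (.ask .randVert fun _ => loopState body (j + 1) (body (j + 1))) := rfl

theorem act_loopState_ask (j : ℕ) (q : Query) (hq : q ∈ advancedModel)
    (next : Answer → Prog (Option ℝ)) :
    (loop body).act (loopState body j (.ask q hq next)) =
      PMF.pure (.ask q fun a => loopState body j (next a)) := rfl

theorem loop_inModel : (loop body).InModel advancedModel := by
  rintro s q next h
  obtain ⟨j, p, rfl⟩ : ∃ j p, s = loopState body j p := ⟨s.1, s.2, rfl⟩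
  cases p with
  | ret o =>
    cases o with
    | some v =>
      rw [act_loopState_ret_some, PMF.support_pure] at h
      cases h
    | none =>
      rw [act_loopState_ret_none, PMF.support_pure] at h
      cases h
      simp [advancedModel]
  | ask q' hq' next' =>
    rw [act_loopState_ask, PMF.support_pure] at h
    cases h
    exact hq'

/-- Invariant: in every reachable state the remaining program is safe for the vertices revealed so
far. Safety of each `body j` from an arbitrary `K` restores it when the next program starts. -/
theorem loop_onlyDiscovered {c : ℕ → ℕ}
    (h : ∀ j K, (body j).Safe G (fun _ _ => True) K (c j)) : (loop body).OnlyDiscovered G := by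
  have key : ∀ (s : (loop body).State) K, (loop body).Reachable G s K →
      ∃ j p c, s = loopState body j p ∧ p.Safe G (fun _ _ => True) K c := by
    intro s K hs
    induction hs with
    | start => exact ⟨0, body 0, _, rfl, h 0 ∅⟩
    | step s K q next a _ hask ha ih =>
      obtain ⟨j, p, c', rfl, hc'⟩ := ih
      cases p with
      | ret o =>
        cases o with
        | some v =>
          rw [act_loopState_ret_some, PMF.support_pure] at hask
          cases hask
        | none =>
          rw [act_loopState_ret_none, PMF.support_pure] at hask
          cases hask
          exact ⟨_, _, _, rfl, h _ _⟩
      | ask q' hq' next' =>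
        rw [act_loopState_ask, PMF.support_pure] at hask
        cases hask
        exact ⟨_, _, _, rfl, hc'.2.2 a ha⟩
  rintro s K q next hs hask
  obtain ⟨j, p, c', rfl, hc'⟩ := key _ K hs
  cases p with
  | ret o =>
    cases o with
    | some v =>
      rw [act_loopState_ret_some, PMF.support_pure] at hask
      cases hask
    | none =>
      rw [act_loopState_ret_none, PMF.support_pure] at hask
      cases hask
      simp [Query.vertices]
  | ask q' hq' next' =>
    rw [act_loopState_ask, PMF.support_pure] at hask
    cases hask
    exact hc'.1

/-- As `Safe` charges cost plus one per query, `c` bounds both the cost and the number of moves. The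
additional move either outputs or asks for a random vertex, ignored, to start the next program; a
move that asks nothing does not exist. Antitonicity of `g` allows the actual cost to be replaced by
its bound. -/
theorem expect_dist_le_payoff_loop {Q : Option ℝ → Finset ℕ → Prop} (j t : ℕ)
    (p : Prog (Option ℝ)) :
    ∀ (K : Finset ℕ) (c : ℕ) (g : ℝ → ℕ → ℝ≥0∞), (∀ v, Antitone (g v)) → p.Safe G Q K c →
      (expect (p.dist G) fun o => o.elim
        ((loop body).payoff G t (loopState body (j + 1) (body (j + 1))) fun v q => g v (c + 1 + q))
        fun v => g v c) ≤ (loop body).payoff G (c + 1 + t) (loopState body j p) g := by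
  induction p with
  | ret o =>
    intro K c g hg _
    rw [show c + 1 + t = c + t + 1 by ring, Algorithm.payoff_succ]
    cases o with
    | some v =>
      simp only [Prog.dist, act_loopState_ret_some, expect_pure, Option.elim]
      exact hg v (Nat.zero_le _)
    | none =>
      simp only [Prog.dist, act_loopState_ret_none, expect_pure, Option.elim, expect_const]
      refine ((loop body).payoff_mono G (fun v q => ?_) _ _).trans
        ((loop body).payoff_monotone G _ _ (Nat.le_add_left t c))
      exact hg v (by simp [Query.cost])
  | ask q hq next ih =>
    intro K c g hg hp
    obtain ⟨c', rfl⟩ := Nat.exists_eq_add_of_le hp.2.1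
    rw [show q.cost + 1 + c' + 1 + t = (q.cost + (c' + 1 + t)) + 1 by ring,
      Algorithm.payoff_succ]
    simp only [Prog.dist, act_loopState_ask, expect_pure, expect_bind]
    refine expect_mono_of_support fun a ha => ?_
    have hs := hp.2.2 a ha
    rw [Nat.add_sub_cancel_left] at hs
    refine le_trans ?_ ((ih a _ c' (fun v k => g v (q.cost + k))
      (fun v k k' hk => hg v (by omega)) hs).trans
        ((loop body).payoff_monotone G _ _ (Nat.le_add_left _ q.cost)))
    refine expect_mono fun o => ?_
    cases o with
    | some v =>
      simp only [Option.elim]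
      exact hg v (by omega)
    | none =>
      simp only [Option.elim]
      exact (loop body).payoff_mono G (fun v k => hg v (by omega)) _ _

/-- The probability that one of `body j, …, body (j + R - 1)` returns a number and that the first
such number satisfies `E`. -/
noncomputable def firstReturn (G : InputGraph) (E : ℝ → Prop) : ℕ → ℕ → ℝ≥0∞
  | 0, _ => 0
  | R + 1, j => expect ((body j).dist G) fun o => o.elim (firstReturn G E R (j + 1))
      (open Classical in fun v => if E v then 1 else 0)

open Classical in
theorem firstReturn_le_payoff_loop {Q : Option ℝ → Finset ℕ → Prop} {c : ℕ → ℕ}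
    (h : ∀ j K, (body j).Safe G Q K (c j)) (E : ℝ → Prop) (R : ℕ) : ∀ (j b : ℕ),
      ∑ i ∈ Finset.range R, (c (j + i) + 1) ≤ b →
      firstReturn body G E R j ≤
        (loop body).payoff G (∑ i ∈ Finset.range R, (c (j + i) + 1))
          (loopState body j (body j))
          fun v q => if E v ∧ q ≤ b then 1 else 0 := by
  induction R with
  | zero => intro j b _; simp [firstReturn]
  | succ R ih =>
    intro j b hb
    have hshift : ∀ i, c (j + (i + 1)) = c (j + 1 + i) := fun i => by rw [add_right_comm]; rfl
    rw [Finset.sum_range_succ'] at hb ⊢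
    simp only [hshift, add_zero] at hb ⊢
    set S := ∑ i ∈ Finset.range R, (c (j + 1 + i) + 1) with hS
    rw [add_comm S]
    refine le_trans ?_ (expect_dist_le_payoff_loop body j S (body j) ∅ (c j) _ ?_ (h j ∅))
    · rw [firstReturn]
      refine expect_mono fun o => ?_
      cases o with
      | some v =>
        have : c j ≤ b := by omega
        simp [this]
      | none =>
        refine (ih (j + 1) (b - (c j + 1)) (by omega)).trans ?_
        simp only [Option.elim]
        refine (loop body).payoff_mono G (fun v q => ?_) _ _
        by_cases hE : E v
        · by_cases hq : q ≤ b - (c j + 1)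
          · have : c j + 1 + q ≤ b := by omega
            simp [hE, hq, this]
          · simp [hq]
        · simp [hE]
    · intro v q q' hq
      by_cases hE : E v
      · by_cases hqb : q' ≤ b
        · have : q ≤ b := hq.trans hqb
          simp [hE, hqb, this]
        · simp [hqb]
      · simp [hE]

theorem firstReturn_le_prob_loop {Q : Option ℝ → Finset ℕ → Prop} {c : ℕ → ℕ}
    (h : ∀ j K, (body j).Safe G Q K (c j)) (E : ℝ → Prop) (R : ℕ) {E' : ℝ → ℕ → Prop}
    (hE : ∀ v q, E v → q ≤ ∑ i ∈ Finset.range R, (c i + 1) → E' v q) :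
    firstReturn body G E R 0 ≤ (loop body).prob G E' := by
  classical
  have h0 := firstReturn_le_payoff_loop body h E R 0 _ le_rfl
  simp only [zero_add] at h0
  refine h0.trans ?_
  rw [Algorithm.prob_eq_iSup_payoff]
  refine le_trans ?_ (le_iSup _ (∑ i ∈ Finset.range R, (c i + 1)))
  refine (loop body).payoff_mono G (fun v q => ?_) _ _
  by_cases hv : E v ∧ q ≤ ∑ i ∈ Finset.range R, (c i + 1)
  · rw [if_pos hv, if_pos (hE v q hv.1 hv.2)]
  · rw [if_neg hv]; exact zero_le

end Loop

/-! ### Orientation by degree and the degree threshold. -/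

namespace InputGraph

variable (G : InputGraph)

/-- The degree of a vertex. -/
noncomputable def deg (x : ℕ) : ℕ := (G.nbrs x).card

variable {G}

theorem mem_nbrs {x y : ℕ} : y ∈ G.nbrs x ↔ G.graph.Adj x y := by
  classical
  rw [nbrs, Finset.mem_filter]
  exact ⟨fun h => h.2, fun h => ⟨G.mem_of_adj y x h.symm, h⟩⟩

theorem mem_verts_of_mem_nbrs {x y : ℕ} (h : y ∈ G.nbrs x) : y ∈ G.verts :=
  G.mem_of_adj y x (mem_nbrs.mp h).symm

theorem mem_nbrs_comm {x y : ℕ} : y ∈ G.nbrs x ↔ x ∈ G.nbrs y := by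
  rw [mem_nbrs, mem_nbrs, SimpleGraph.adj_comm]

theorem deg_pos {x : ℕ} (hx : x ∈ G.verts) : 0 < G.deg x := (Prog.nbrs_nonempty hx).card_pos

theorem deg_lt_numVerts {x : ℕ} (hx : x ∈ G.verts) : G.deg x < G.numVerts := by
  refine Finset.card_lt_card ((Finset.ssubset_iff_of_subset fun y hy => ?_).mpr ⟨x, hx, ?_⟩)
  · exact mem_verts_of_mem_nbrs hy
  · rw [mem_nbrs]; exact G.graph.irrefl

variable (G)

theorem numVerts_pos : 0 < G.numVerts := G.nonempty.card_pos

theorem sum_deg : ∑ x ∈ G.verts, (G.deg x : ℝ) = G.numVerts * G.avgDegree := by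
  rw [avgDegree_eq_sum, mul_div_cancel₀]
  · rfl
  · exact_mod_cast G.numVerts_pos.ne'

theorem one_le_avgDegree : 1 ≤ G.avgDegree := by
  rw [avgDegree_eq_sum, one_le_div (by exact_mod_cast G.numVerts_pos), numVerts,
    Finset.card_eq_sum_ones]
  push_cast
  exact Finset.sum_le_sum fun x hx => by exact_mod_cast deg_pos hx

theorem avgDegree_le_numVerts : G.avgDegree ≤ G.numVerts := by
  have hn : (0 : ℝ) < G.numVerts := by exact_mod_cast G.numVerts_pos
  rw [avgDegree_eq_sum, div_le_iff₀ hn]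
  calc _ ≤ ∑ x ∈ G.verts, (G.numVerts : ℝ) :=
        Finset.sum_le_sum fun x hx => by exact_mod_cast (deg_lt_numVerts hx).le
    _ = _ := by rw [Finset.sum_const, nsmul_eq_mul]; rfl

/-- The order of the vertices by degree, ties being broken by the identifier. -/
def Below (v u : ℕ) : Prop := G.deg v < G.deg u ∨ (G.deg v = G.deg u ∧ v < u)

open Classical in
/-- The neighbours of `v` that follow it in the order by degree. -/
noncomputable def out (v : ℕ) : Finset ℕ := (G.nbrs v).filter (G.Below v)

/-- `Below` orders any two distinct vertices in exactly one way, so reversing edges matches the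
ascending ones with the others, and each kind makes up half of the degree sum. -/
theorem sum_card_out : 2 * ∑ v ∈ G.verts, ((G.out v).card : ℝ) = G.numVerts * G.avgDegree := by
  classical
  have h1 : ∑ v ∈ G.verts, (G.out v).card =
      ∑ v ∈ G.verts, ((G.nbrs v).filter fun u => ¬ G.Below v u).card := by
    have e1 : ∀ v ∈ G.verts, (G.out v).card =
        ∑ u ∈ G.verts, if u ∈ G.nbrs v ∧ G.Below v u then 1 else 0 := by
      intro v _
      rw [← Finset.card_filter]
      congr 1
      ext u
      rw [out, Finset.mem_filter, Finset.mem_filter]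
      exact ⟨fun h => ⟨mem_verts_of_mem_nbrs h.1, h⟩, fun h => h.2⟩
    have e2 : ∀ v ∈ G.verts, ((G.nbrs v).filter fun u => ¬ G.Below v u).card =
        ∑ u ∈ G.verts, if v ∈ G.nbrs u ∧ G.Below u v then 1 else 0 := by
      intro v _
      rw [← Finset.card_filter]
      congr 1
      ext u
      rw [Finset.mem_filter, Finset.mem_filter, mem_nbrs_comm]
      constructor
      · rintro ⟨h, hb⟩
        refine ⟨mem_verts_of_mem_nbrs (mem_nbrs_comm.mp h), h, ?_⟩
        have hne : u ≠ v := fun e => G.graph.irrefl (v := v) (by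
          have := mem_nbrs.mp h; rwa [e] at this)
        simp only [Below] at hb ⊢
        omega
      · rintro ⟨-, h, hb⟩
        refine ⟨h, ?_⟩
        simp only [Below] at hb ⊢
        omega
    rw [Finset.sum_congr rfl e1, Finset.sum_congr rfl e2, Finset.sum_comm]
  have h2 : 2 * ∑ v ∈ G.verts, (G.out v).card = ∑ v ∈ G.verts, G.deg v := by
    rw [two_mul]
    nth_rw 2 [h1]
    rw [← Finset.sum_add_distrib]
    exact Finset.sum_congr rfl fun v _ => Finset.card_filter_add_card_filter_not _
  rw [← sum_deg]
  exact_mod_cast h2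

/-- Every out-neighbour has degree at least deg v, hence at least |out v|; summing this over the
out-neighbours stays below the sum of all degrees. -/
theorem card_out_sq_le (v : ℕ) : ((G.out v).card : ℝ) ^ 2 ≤ G.numVerts * G.avgDegree := by
  classical
  rw [← sum_deg, sq]
  calc ((G.out v).card : ℝ) * (G.out v).card = ∑ u ∈ G.out v, ((G.out v).card : ℝ) := by
        rw [Finset.sum_const, nsmul_eq_mul]
    _ ≤ ∑ u ∈ G.out v, (G.deg u : ℝ) := by
        refine Finset.sum_le_sum fun u hu => ?_
        have h1 : (G.out v).card ≤ G.deg v := Finset.card_filter_le _ _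
        have h2 : G.deg v ≤ G.deg u := by
          rcases (Finset.mem_filter.mp hu).2 with h | h
          · exact h.le
          · exact h.1.le
        exact_mod_cast h1.trans h2
    _ ≤ _ := Finset.sum_le_sum_of_subset_of_nonneg
        (fun u hu => mem_verts_of_mem_nbrs (Finset.mem_filter.mp hu).1)
        fun _ _ _ => by positivity

open Classical in
theorem edgesIn_pair (a b : ℕ) :
    G.edgesIn {a, b} = if a ∈ G.nbrs b then 1 else 0 := by
  have h := G.two_mul_edgesIn {a, b}
  by_cases hab : a = b
  · subst hab
    have h0 : a ∉ G.nbrs a := fun h => G.graph.irrefl (mem_nbrs.mp h)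
    rw [mem_nbrs] at h0
    simp only [mem_nbrs, if_neg h0]
    rw [Finset.pair_eq_singleton, Finset.card_filter, Finset.sum_product, Finset.sum_singleton,
      Finset.sum_singleton, if_neg h0] at h
    rw [Finset.pair_eq_singleton]
    omega
  · rw [Finset.card_filter, Finset.sum_product] at h
    have hba : b ≠ a := Ne.symm hab
    simp only [Finset.sum_pair hab, SimpleGraph.irrefl, if_false, zero_add, add_zero,
      G.graph.adj_comm b a] at h
    simp only [mem_nbrs, G.graph.adj_comm b a]
    split_ifs at h ⊢ <;> omega

-- Repeated entries are counted several times on the right, hence only an inequality.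
open Classical in
theorem two_mul_edgesIn_toFinset_le (l : List ℕ) : 2 * G.edgesIn l.toFinset ≤
    (l.map fun x => (l.map fun y => if y ∈ G.nbrs x then 1 else 0).sum).sum := by
  have key : ∀ f : ℕ → ℕ, ∑ x ∈ l.toFinset, f x ≤ (l.map f).sum := fun f => by
    rw [Finset.sum_list_map_count]
    refine Finset.sum_le_sum fun x hx => ?_
    rw [smul_eq_mul]
    exact Nat.le_mul_of_pos_left _ (List.count_pos_iff.mpr (List.mem_toFinset.mp hx))
  rw [two_mul_edgesIn, Finset.card_filter, Finset.sum_product]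
  refine (Finset.sum_le_sum fun x _ => key _).trans ((key _).trans (le_of_eq ?_))
  simp only [mem_nbrs]

variable (θ : ℝ)

open Classical in
/-- The neighbours of `x` that lie on the same side of the degree threshold `θ`. -/
noncomputable def sameSide (x : ℕ) : Finset ℕ :=
  (G.nbrs x).filter fun y => ((G.deg x : ℝ) ≤ θ ↔ (G.deg y : ℝ) ≤ θ)

open Classical in
/-- The neighbours of `x` of degree greater than `θ`. -/
noncomputable def highNbrs (x : ℕ) : Finset ℕ :=
  (G.nbrs x).filter fun y => θ < G.deg y

variable {θ}

/-- Below the threshold the degree itself is the bound. Above it, each counted neighbour has degree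
more than θ, and the degrees sum to θ², so there are fewer than θ of them. -/
theorem card_sameSide_le (hθ : 0 < θ) (h : θ ^ 2 = G.numVerts * G.avgDegree) (x : ℕ) :
    ((G.sameSide θ x).card : ℝ) ≤ θ := by
  classical
  by_cases hx : (G.deg x : ℝ) ≤ θ
  · refine le_trans ?_ hx
    exact_mod_cast Finset.card_filter_le _ _
  · have h1 : ((G.sameSide θ x).card : ℝ) * θ ≤ θ ^ 2 := by
      rw [h, ← sum_deg, ← nsmul_eq_mul, ← Finset.sum_const]
      refine (Finset.sum_le_sum (g := fun y => (G.deg y : ℝ)) fun y hy => ?_).trans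
        (Finset.sum_le_sum_of_subset_of_nonneg
          (fun u hu => mem_verts_of_mem_nbrs (Finset.mem_filter.mp hu).1)
          fun _ _ _ => by positivity)
      have := (Finset.mem_filter.mp hy).2
      rw [iff_false_left hx, not_le] at this
      exact this.le
    nlinarith

-- An edge across the threshold is counted once, from its low end, but contributes to the degrees of
-- both ends; this gives the factor 2.
open Classical in
theorem sum_sameSide_add_sum_highNbrs :
    ∑ x ∈ G.verts, ((G.sameSide θ x).card : ℝ) +
      2 * ∑ x ∈ G.verts.filter (fun x => (G.deg x : ℝ) ≤ θ), ((G.highNbrs θ x).card : ℝ) =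
        G.numVerts * G.avgDegree := by
  have hlow : ∑ x ∈ G.verts.filter (fun x => (G.deg x : ℝ) ≤ θ), (G.highNbrs θ x).card =
      ∑ x ∈ G.verts, ∑ y ∈ G.verts,
        if y ∈ G.nbrs x ∧ (G.deg x : ℝ) ≤ θ ∧ θ < G.deg y then 1 else 0 := by
    rw [Finset.sum_filter]
    refine Finset.sum_congr rfl fun x _ => ?_
    rw [← Finset.card_filter]
    split_ifs with hx
    · congr 1
      ext y
      rw [highNbrs, Finset.mem_filter, Finset.mem_filter]
      exact ⟨fun h => ⟨mem_verts_of_mem_nbrs h.1, h.1, hx, h.2⟩, fun h => ⟨h.2.1, h.2.2.2⟩⟩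
    · symm
      rw [Finset.card_eq_zero, Finset.filter_eq_empty_iff]
      exact fun y _ h => hx h.2.1
  have hsplit : ∀ x ∈ G.verts, G.deg x = (G.sameSide θ x).card +
      ((∑ y ∈ G.verts, if y ∈ G.nbrs x ∧ (G.deg x : ℝ) ≤ θ ∧ θ < G.deg y then 1 else 0) +
        ∑ y ∈ G.verts, if x ∈ G.nbrs y ∧ (G.deg y : ℝ) ≤ θ ∧ θ < G.deg x then 1 else 0) := by
    intro x _
    refine (Finset.card_filter_add_card_filter_not (s := G.nbrs x)
      (fun y => ((G.deg x : ℝ) ≤ θ ↔ (G.deg y : ℝ) ≤ θ))).symm.trans ?_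
    rw [sameSide]
    congr 1
    rw [← Finset.sum_add_distrib]
    have : (G.nbrs x).filter (fun y => ¬ ((G.deg x : ℝ) ≤ θ ↔ (G.deg y : ℝ) ≤ θ)) =
        G.verts.filter fun y => y ∈ G.nbrs x ∧ ¬ ((G.deg x : ℝ) ≤ θ ↔ (G.deg y : ℝ) ≤ θ) := by
      ext y
      rw [Finset.mem_filter, Finset.mem_filter]
      exact ⟨fun h => ⟨mem_verts_of_mem_nbrs h.1, h⟩, fun h => h.2⟩
    rw [this, Finset.card_filter]
    refine Finset.sum_congr rfl fun y _ => ?_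
    simp only [mem_nbrs_comm (x := y) (y := x)]
    by_cases h1 : y ∈ G.nbrs x <;> by_cases h2 : (G.deg x : ℝ) ≤ θ <;>
      by_cases h3 : (G.deg y : ℝ) ≤ θ <;> simp [h1, h2, h3, ← not_le]
  have hdeg : ∑ x ∈ G.verts, G.deg x = ∑ x ∈ G.verts, (G.sameSide θ x).card +
      2 * ∑ x ∈ G.verts.filter (fun x => (G.deg x : ℝ) ≤ θ), (G.highNbrs θ x).card := by
    rw [Finset.sum_congr rfl hsplit, Finset.sum_add_distrib, Finset.sum_add_distrib, hlow, two_mul]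
    congr 2
    exact Finset.sum_comm
  rw [← sum_deg]
  exact_mod_cast hdeg.symm

end InputGraph

/-! ### Moments of sums over random vertices and over pairs of samples. -/

/-- A uniformly random vertex. -/
noncomputable def unif (G : InputGraph) : PMF ℕ := PMF.uniformOfFinset G.verts G.nonempty

section Unif

variable {G : InputGraph}

theorem mem_support_unif {x : ℕ} : x ∈ (unif G).support ↔ x ∈ G.verts := by
  rw [unif, PMF.mem_support_uniformOfFinset_iff]

theorem expect_uniformOfFinset_ofReal {s : Finset ℕ} (hs : s.Nonempty) {f : ℕ → ℝ}
    (hf : ∀ x, 0 ≤ f x) :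
    expect (PMF.uniformOfFinset s hs) (fun x => ENNReal.ofReal (f x)) =
      ENNReal.ofReal ((∑ x ∈ s, f x) / s.card) := by
  rw [expect_uniformOfFinset, ENNReal.ofReal_div_of_pos (by exact_mod_cast hs.card_pos),
    ENNReal.ofReal_sum_of_nonneg fun x _ => hf x, ENNReal.ofReal_natCast, ENNReal.div_eq_inv_mul,
    mul_comm]

theorem expect_unif_ofReal {f : ℕ → ℝ} (hf : ∀ x, 0 ≤ f x) :
    expect (unif G) (fun x => ENNReal.ofReal (f x)) =
      ENNReal.ofReal ((∑ x ∈ G.verts, f x) / G.numVerts) :=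
  expect_uniformOfFinset_ofReal _ hf

open Classical in
theorem expect_unif_mem {S : Finset ℕ} (hS : S ⊆ G.verts) :
    expect (unif G) (fun x => if x ∈ S then 1 else 0) =
      ENNReal.ofReal ((S.card : ℝ) / G.numVerts) := by
  have h := expect_unif_ofReal (G := G) (f := fun x => if x ∈ S then 1 else 0)
    fun x => by split_ifs <;> simp
  have e : ∀ x, ENNReal.ofReal (if x ∈ S then 1 else 0) = if x ∈ S then (1 : ℝ≥0∞) else 0 :=
    fun x => by split_ifs <;> simp
  simp only [e] at h
  rw [h, Finset.sum_ite_mem, Finset.inter_eq_right.mpr hS, Finset.sum_const, nsmul_one]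

end Unif

section Sampling

variable {α : Type*}

theorem expect_list_sum {β : Type*} (p : PMF α) (l : List β) (f : β → α → ℝ≥0∞) :
    expect p (fun a => (l.map fun b => f b a).sum) = (l.map fun b => expect p (f b)).sum := by
  induction l with
  | nil => simp [expect_const]
  | cons b l ih => simp only [List.map_cons, List.sum_cons, expect_add, ih]

theorem expect_iid_add (p : PMF α) (M N : ℕ) (f : List α → ℝ≥0∞) :
    expect (iid p (M + N)) f =
      expect (iid p M) fun l => expect (iid p N) fun l' => f (l ++ l') := by
  induction M generalizing f with
  | zero => simp [iid, expect_pure]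
  | succ M ih => rw [Nat.add_right_comm, expect_iid_succ, expect_iid_succ]; simp only [ih,
      List.cons_append]

theorem mem_support_of_mem_iid {p : PMF α} {N : ℕ} : ∀ {l : List α}, l ∈ (iid p N).support →
    ∀ a ∈ l, a ∈ p.support := by
  induction N with
  | zero =>
    intro l hl a ha
    rw [iid, PMF.mem_support_pure_iff] at hl
    simp [hl] at ha
  | succ N ih =>
    intro l hl a ha
    rw [iid, PMF.mem_support_bind_iff] at hl
    obtain ⟨b, hb, hl⟩ := hl
    rw [PMF.mem_support_bind_iff] at hl
    obtain ⟨l', hl', hl⟩ := hl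
    rw [PMF.mem_support_pure_iff] at hl
    subst hl
    rcases List.mem_cons.mp ha with rfl | ha
    · exact hb
    · exact ih hl' a ha

-- Chebyshev for the number of successes, with deviation equal to its mean Nμ and variance at most
-- Nμ.
open Classical in
theorem pr_iid_forall_not_le (p : PMF α) (E : α → Prop) {N : ℕ} (hN : 0 < N) {μ : ℝ} (hμ : 0 < μ)
    (h : pr p E = ENNReal.ofReal μ) :
    pr (iid p N) (fun l => ∀ x ∈ l, ¬ E x) ≤ ENNReal.ofReal (1 / (N * μ)) := by
  have hN' : (0 : ℝ) < N := by exact_mod_cast hN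
  have h1 : expect p (fun a => ((if E a then 1 else 0 : ℕ) : ℝ≥0∞)) = ENNReal.ofReal μ := by
    rw [← h, pr]; congr 1; funext a; split_ifs <;> simp
  have h2 : expect p (fun a => ((if E a then 1 else 0 : ℕ) : ℝ≥0∞) ^ 2) ≤ ENNReal.ofReal μ := by
    rw [← h, pr]; refine le_of_eq ?_; congr 1; funext a; split_ifs <;> simp
  refine le_trans (pr_mono fun l _ hl => ?_)
    ((pr_iid_sum_le p (fun a => if E a then 1 else 0) N (r := N * μ) hμ.le hμ.le
      (by positivity) h1 h2).trans (le_of_eq ?_))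
  · have : (l.map fun a => if E a then 1 else 0).sum = 0 := by
      rw [List.sum_eq_zero]
      intro k hk
      obtain ⟨a, ha, rfl⟩ := List.mem_map.mp hk
      simp [hl a ha]
    rw [this]; simp
  · congr 1; field_simp

/-- The second moment of the number of related pairs between two lists of samples. -/
theorem expect_cross_sum_sq_le (p : PMF α) (F : α → α → ℝ≥0∞) (hF : ∀ x y, F x y ^ 2 = F x y)
    {τ P : ℝ≥0∞} (h₁ : ∀ x, expect p (fun y => F x y) ≤ τ)
    (h₂ : ∀ y, expect p (fun x => F x y) ≤ τ)
    (hP : (expect p fun x => expect p fun y => F x y) = P) (N : ℕ) :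
    (expect (iid p N) fun l => expect (iid p N) fun l' =>
      (l'.map fun y => (l.map fun x => F x y).sum).sum ^ 2) ≤
        (N : ℝ≥0∞) ^ 2 * P + 2 * N ^ 3 * τ * P + (N ^ 2 * P) ^ 2 := by
  have hP' : (expect p fun y => expect p fun x => F x y) = P := by rw [← hP, expect_comm]
  have hsq : ∀ {g : α → ℝ≥0∞}, (∀ x, g x ≤ τ) → expect p (fun x => g x ^ 2) ≤ τ * expect p g := by
    intro g hg
    rw [← expect_const_mul]
    exact expect_mono fun x => by rw [sq]; gcongr; exact hg x
  -- The three terms of the bound come from coinciding pairs, from pairs sharing one sample (at most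
  -- τP for each of the 2N³ choices), and from pairs without a common sample.
  calc _ ≤ expect (iid p N) fun l => N * expect p (fun y => (l.map fun x => F x y).sum ^ 2) +
        (N * (l.map fun x => expect p fun y => F x y).sum) ^ 2 := by
        refine expect_mono fun l => (expect_iid_sum_sq_le p _ N).trans ?_
        rw [expect_list_sum]
    _ = N * expect p (fun y => expect (iid p N) fun l => (l.map fun x => F x y).sum ^ 2) +
        (N : ℝ≥0∞) ^ 2 *
          expect (iid p N) fun l => (l.map fun x => expect p fun y => F x y).sum ^ 2 := by
        simp only [mul_pow]
        rw [expect_add, expect_const_mul, expect_const_mul, expect_comm]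
    _ ≤ N * expect p (fun y => N * expect p (fun x => F x y) +
          N ^ 2 * (expect p fun x => F x y) ^ 2) +
            (N : ℝ≥0∞) ^ 2 * (N * (τ * P) + (N * P) ^ 2) := by
        gcongr N * ?_ + _ * ?_
        · refine expect_mono fun y => (expect_iid_sum_sq_le p _ N).trans (le_of_eq ?_)
          simp only [hF, mul_pow]
        · refine (expect_iid_sum_sq_le p _ N).trans ?_
          gcongr
          · exact (hsq h₁).trans (by rw [hP])
          · rw [hP]
    _ ≤ N * (N * P + N ^ 2 * (τ * P)) + (N : ℝ≥0∞) ^ 2 * (N * (τ * P) + (N * P) ^ 2) := by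
        gcongr N * ?_ + _
        rw [expect_add, expect_const_mul, expect_const_mul, hP']
        gcongr
        exact (hsq h₂).trans (by rw [hP'])
    _ = _ := by ring

theorem expect_cross_sum (p : PMF α) (F : α → α → ℝ≥0∞) (N : ℕ) :
    (expect (iid p N) fun l => expect (iid p N) fun l' =>
      (l'.map fun y => (l.map fun x => F x y).sum).sum) =
        (N : ℝ≥0∞) ^ 2 * expect p fun x => expect p fun y => F x y := by
  simp only [expect_iid_sum, expect_list_sum, expect_const_mul]
  ring

/-- Two lists of `N` samples are likely to contain a related pair. -/
theorem expect_pr_cross_sum_eq_zero_le (p : PMF α) (F : α → α → ℕ)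
    (hF : ∀ x y, F x y = 0 ∨ F x y = 1) {τ ρ : ℝ} (hτ : 0 ≤ τ) (hρ : 0 < ρ)
    (h₁ : ∀ x, expect p (fun y => (F x y : ℝ≥0∞)) ≤ ENNReal.ofReal τ)
    (h₂ : ∀ y, expect p (fun x => (F x y : ℝ≥0∞)) ≤ ENNReal.ofReal τ)
    (hP : (expect p fun x => expect p fun y => (F x y : ℝ≥0∞)) = ENNReal.ofReal ρ)
    {N : ℕ} (hN : 0 < N) :
    (expect (iid p N) fun l => pr (iid p N) fun l' =>
      (l'.map fun y => (l.map fun x => F x y).sum).sum = 0) ≤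
        ENNReal.ofReal ((1 + 2 * N * τ) / (N ^ 2 * ρ)) := by
  have hN' : (0 : ℝ) < N := by exact_mod_cast hN
  set q : PMF (List α × List α) := (iid p N).bind fun l =>
    (iid p N).bind fun l' => PMF.pure (l, l') with hq
  obtain ⟨Y, hY⟩ : ∃ Y : List α × List α → ℕ, ∀ l l', Y (l, l') =
    (l'.map fun y => (l.map fun x => F x y).sum).sum :=
      ⟨fun r => (r.2.map fun y => (r.1.map fun x => F x y).sum).sum, fun _ _ => rfl⟩
  have hcast : ∀ l l', (Y (l, l') : ℝ≥0∞) =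
      (l'.map fun y => (l.map fun x => (F x y : ℝ≥0∞)).sum).sum := by
    intro l l'
    simp only [hY, natCast_sum_map]
  have m1 : expect q (fun r => (Y r : ℝ≥0∞)) = ENNReal.ofReal ((N : ℝ) ^ 2 * ρ) := by
    simp only [hq, expect_bind, expect_pure, hcast]
    rw [expect_cross_sum p (fun x y => (F x y : ℝ≥0∞)), hP,
      ENNReal.ofReal_mul (by positivity), ENNReal.ofReal_pow hN'.le, ENNReal.ofReal_natCast]
  have m2 : expect q (fun r => (Y r : ℝ≥0∞) ^ 2) ≤
      ENNReal.ofReal (((N : ℝ) ^ 2 * ρ) ^ 2 + ((N : ℝ) ^ 2 * ρ + 2 * N ^ 3 * τ * ρ)) := by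
    simp only [hq, expect_bind, expect_pure, hcast]
    refine (expect_cross_sum_sq_le p (fun x y => (F x y : ℝ≥0∞)) ?_ h₁ h₂ hP N).trans
      (le_of_eq ?_)
    · intro x y; rcases hF x y with h | h <;> simp [h]
    · rw [add_comm, ENNReal.ofReal_add (by positivity) (by positivity),
        ENNReal.ofReal_add (by positivity) (by positivity),
        ENNReal.ofReal_pow (by positivity), ENNReal.ofReal_mul (by positivity),
        ENNReal.ofReal_mul (by positivity), ENNReal.ofReal_mul (by positivity),
        ENNReal.ofReal_mul (by positivity), ENNReal.ofReal_pow (by positivity),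
        ENNReal.ofReal_pow (by positivity), ENNReal.ofReal_natCast, ENNReal.ofReal_ofNat]
  have hcheb := pr_le_ofReal_div (by positivity) (mul_pr_le_of_second_moment q Y
    (r := (N : ℝ) ^ 2 * ρ) (by positivity) (by positivity) m1 m2)
  have hpr : (expect (iid p N) fun l => pr (iid p N) fun l' =>
      (l'.map fun y => (l.map fun x => F x y).sum).sum = 0) = pr q fun r => Y r = 0 := by
    simp only [hq, pr, expect_bind, expect_pure, hY]
    congr!
  rw [hpr]
  refine (pr_mono fun r _ hr => ?_).trans (hcheb.trans (le_of_eq ?_))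
  · rw [hr]; simp
  · congr 1
    field_simp

end Sampling

/-! ### The stopping test: edge samples and the two errors of a round. -/

variable {G : InputGraph}

open Classical in
/-- If many edges join vertices on the same side of the degree threshold, then a random set of
vertices is likely to contain an edge. -/
theorem pr_edgesIn_eq_zero_le {θ : ℝ} (hθ : 0 < θ)
    (hθ2 : θ ^ 2 = G.numVerts * G.avgDegree)
    (hF : θ ^ 2 / 2 ≤ ∑ x ∈ G.verts, ((G.sameSide θ x).card : ℝ)) {s : ℕ}
    (hs : (G.numVerts : ℝ) ≤ s * θ) :
    pr (iid (unif G) (s + s)) (fun S => G.edgesIn S.toFinset = 0) ≤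
      ENNReal.ofReal (6 * (G.numVerts / (s * θ))) := by
  set n : ℝ := (G.numVerts : ℝ) with hn
  have hn0 : 0 < n := by rw [hn]; exact_mod_cast G.numVerts_pos
  have hs0 : (0 : ℝ) < s := by
    by_contra hcon
    rw [not_lt] at hcon
    nlinarith
  set F : ℕ → ℕ → ℕ := fun x y => if y ∈ G.sameSide θ x then 1 else 0 with hFdef
  have hsymm : ∀ x y, y ∈ G.sameSide θ x ↔ x ∈ G.sameSide θ y := by
    intro x y
    rw [InputGraph.sameSide, InputGraph.sameSide, Finset.mem_filter, Finset.mem_filter,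
      InputGraph.mem_nbrs_comm]
    tauto
  have hsub : ∀ x, G.sameSide θ x ⊆ G.verts := fun x y hy =>
    InputGraph.mem_verts_of_mem_nbrs (Finset.mem_filter.mp hy).1
  set T := ∑ x ∈ G.verts, ((G.sameSide θ x).card : ℝ) with hT
  have hT0 : 0 < T := lt_of_lt_of_le (by positivity) hF
  have e1 : ∀ x, expect (unif G) (fun y => (F x y : ℝ≥0∞)) =
      ENNReal.ofReal ((G.sameSide θ x).card / n) := by
    intro x
    rw [← expect_unif_mem (hsub x)]
    congr 1; funext y; simp only [hFdef]; split_ifs <;> simp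
  have e2 : ∀ y, expect (unif G) (fun x => (F x y : ℝ≥0∞)) =
      ENNReal.ofReal ((G.sameSide θ y).card / n) := by
    intro y
    rw [← e1 y]
    congr 1; funext x; simp only [hFdef, hsymm x y]
  have eP : (expect (unif G) fun x => expect (unif G) fun y => (F x y : ℝ≥0∞)) =
      ENNReal.ofReal (T / n ^ 2) := by
    simp only [e1]
    rw [expect_unif_ofReal fun x => by positivity, ← Finset.sum_div, ← hT, ← hn]
    congr 1; field_simp
  have hle : ∀ x, ENNReal.ofReal ((G.sameSide θ x).card / n) ≤ ENNReal.ofReal (θ / n) := by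
    intro x
    apply ENNReal.ofReal_le_ofReal
    gcongr
    exact G.card_sameSide_le hθ hθ2 x
  -- The sample is cut into two independent halves, and only edges between them are counted, so that
  -- the second moment bound for two lists applies.
  have hpr : pr (iid (unif G) (s + s)) (fun S => G.edgesIn S.toFinset = 0) ≤
      expect (iid (unif G) s) fun l => pr (iid (unif G) s) fun l' =>
        (l'.map fun y => (l.map fun x => F x y).sum).sum = 0 := by
    rw [pr, expect_iid_add]
    refine expect_mono fun l => pr_mono fun l' _ h0 => ?_
    rw [List.sum_eq_zero]
    intro k hk
    obtain ⟨y, hy, rfl⟩ := List.mem_map.mp hk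
    rw [List.sum_eq_zero]
    intro k hk
    obtain ⟨x, hx, rfl⟩ := List.mem_map.mp hk
    simp only [hFdef]
    rw [if_neg]
    intro hxy
    have h2 := G.two_mul_edgesIn (l ++ l').toFinset
    rw [h0, mul_zero, eq_comm, Finset.card_eq_zero, Finset.filter_eq_empty_iff] at h2
    refine h2 (x := (x, y)) ?_ (InputGraph.mem_nbrs.mp (Finset.mem_filter.mp hxy).1)
    simp [hx, hy]
  have hcheb := expect_pr_cross_sum_eq_zero_le (unif G) F
    (fun x y => by simp only [hFdef]; split_ifs <;> simp) (τ := θ / n) (by positivity)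
    (div_pos hT0 (pow_pos hn0 2)) (fun x => by rw [e1]; exact hle x)
    (fun y => by rw [e2]; exact hle y) eP (N := s) (by exact_mod_cast hs0)
  refine hpr.trans (hcheb.trans (ENNReal.ofReal_le_ofReal ?_))
  clear hpr hcheb e1 e2 eP hle hsub hsymm
  clear_value F T n
  have hσ : n / (s * θ) ≤ 1 := (div_le_one (by positivity)).mpr hs
  have key : (1 + 2 * s * (θ / n)) / ((s : ℝ) ^ 2 * (T / n ^ 2)) =
      (n ^ 2 + 2 * s * θ * n) / (s ^ 2 * T) := by
    field_simp
  rw [key, div_le_iff₀ (by positivity)]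
  have h3 : 6 * (n / (s * θ)) * ((s : ℝ) ^ 2 * T) = 6 * n * s * T / θ := by field_simp
  rw [h3, le_div_iff₀ hθ]
  have h4 : n ^ 2 * θ ≤ n * (s * θ) * θ := by nlinarith [mul_pos hn0 hθ]
  have h5 : 3 * n * s * θ ^ 2 ≤ 6 * n * s * T := by
    have : 0 < n * s := by positivity
    nlinarith
  nlinarith

/-- A vertex, one of its neighbours, and their degrees. -/
structure EdgeSample where
  src : ℕ
  tgt : ℕ
  degSrc : ℕ
  degTgt : ℕ

/-- Twice the degree of the source if the target follows it in the order by degree, else `0`. -/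
def EdgeSample.weight (x : EdgeSample) : ℕ :=
  if x.degSrc < x.degTgt ∨ (x.degSrc = x.degTgt ∧ x.src < x.tgt) then 2 * x.degSrc else 0

namespace Prog

/-- A random neighbour of a random vertex, with the degrees. -/
def edgeSample : Prog EdgeSample :=
  randVert.bind fun v => (randNbr v).bind fun u => (degree v).bind fun k =>
    (degree u).bind fun k' => ret ⟨v, u, k, k'⟩

/-- Whether a random vertex is adjacent to `b` (as a number). -/
def hit (b : ℕ) : Prog ℕ := randVert.bind fun a => edgesIn {a, b}

/-- The decision of a round, given the edge samples `L` and the number `e` of edges seen in a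
random set of vertices. -/
def verdict (s : ℕ) (L : List EdgeSample) (e : ℕ) : Prog Bool :=
  match L.argmax EdgeSample.degTgt with
  | none => ret (decide (1 ≤ e))
  | some x => ((hit x.tgt).replicate s).bind fun H =>
      ret (decide (1 ≤ e ∨ x.degTgt ≤ (L.map EdgeSample.weight).sum * H.sum))

/-- A test that is unlikely to succeed if `s ^ 2` is much smaller than `n / d`, and likely to
succeed if it is much larger. -/
def round (s : ℕ) : Prog Bool :=
  (edgeSample.replicate s).bind fun L => (randVert.replicate (s + s)).bind fun S =>
    (edgesIn S.toFinset).bind fun e => verdict s L e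

end Prog

/-- The vertices named in an edge sample are neighbours, and the degrees are right. -/
def EdgeSample.Valid (G : InputGraph) (x : EdgeSample) : Prop :=
  x.src ∈ G.verts ∧ x.tgt ∈ G.nbrs x.src ∧ x.degSrc = G.deg x.src ∧ x.degTgt = G.deg x.tgt

theorem expect_edgeSample (f : EdgeSample → ℝ≥0∞) :
    expect (Prog.edgeSample.dist G) f = expect (unif G) fun v =>
      expect ((Prog.randNbr v).dist G) fun u => f ⟨v, u, G.deg v, G.deg u⟩ := by
  simp only [Prog.edgeSample, Prog.dist_bind, expect_bind, Prog.dist, expect_pure,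
    Prog.dist_randVert]
  refine expect_congr_of_support fun v hv => ?_
  rw [PMF.mem_support_uniformOfFinset_iff] at hv
  refine expect_congr_of_support fun u hu => ?_
  rw [Prog.dist_randNbr hv, PMF.mem_support_uniformOfFinset_iff] at hu
  rw [Prog.dist_degree hv, Prog.dist_degree (InputGraph.mem_verts_of_mem_nbrs hu), expect_pure,
    expect_pure]
  rfl

theorem valid_of_mem_support {x : EdgeSample} (hx : x ∈ (Prog.edgeSample.dist G).support) :
    x.Valid G := by
  simp only [Prog.edgeSample, Prog.dist_bind, Prog.dist, Prog.dist_randVert] at hx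
  rw [PMF.mem_support_bind_iff] at hx
  obtain ⟨v, hv, hx⟩ := hx
  rw [PMF.mem_support_uniformOfFinset_iff] at hv
  rw [PMF.mem_support_bind_iff] at hx
  obtain ⟨u, hu, hx⟩ := hx
  rw [Prog.dist_randNbr hv, PMF.mem_support_uniformOfFinset_iff] at hu
  rw [Prog.dist_degree hv, Prog.dist_degree (InputGraph.mem_verts_of_mem_nbrs hu),
    PMF.pure_bind, PMF.pure_bind, PMF.mem_support_pure_iff] at hx
  subst hx
  exact ⟨hv, hu, rfl, rfl⟩

theorem expect_edgeSample_ofReal {f : EdgeSample → ℝ} (hf : ∀ x, 0 ≤ f x) :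
    expect (Prog.edgeSample.dist G) (fun x => ENNReal.ofReal (f x)) = ENNReal.ofReal
      ((∑ v ∈ G.verts, (∑ u ∈ G.nbrs v, f ⟨v, u, G.deg v, G.deg u⟩) / G.deg v) / G.numVerts) := by
  rw [expect_edgeSample, ← expect_unif_ofReal fun v =>
    div_nonneg (Finset.sum_nonneg fun _ _ => hf _) (Nat.cast_nonneg _)]
  refine expect_congr_of_support fun v hv => ?_
  rw [mem_support_unif] at hv
  rw [Prog.dist_randNbr hv]
  exact expect_uniformOfFinset_ofReal (Prog.nbrs_nonempty hv)
    (f := fun u => f ⟨v, u, G.deg v, G.deg u⟩) fun _ => hf _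

theorem weight_mk (v u : ℕ) [Decidable (G.Below v u)] :
    EdgeSample.weight ⟨v, u, G.deg v, G.deg u⟩ = if G.Below v u then 2 * G.deg v else 0 := by
  unfold EdgeSample.weight InputGraph.Below
  congr

/-- The factor deg v in the weight cancels the probability 1/deg v of choosing a given neighbour,
leaving 2|out v| averaged over v. -/
theorem expect_weight : expect (Prog.edgeSample.dist G) (fun x => (x.weight : ℝ≥0∞)) =
    ENNReal.ofReal G.avgDegree := by
  classical
  have h := expect_edgeSample_ofReal (G := G) (f := fun x => (x.weight : ℝ))
    fun x => Nat.cast_nonneg _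
  simp only [ENNReal.ofReal_natCast] at h
  rw [h]
  congr 1
  rw [div_eq_iff (by exact_mod_cast G.numVerts_pos.ne'), mul_comm, ← G.sum_card_out,
    Finset.mul_sum]
  refine Finset.sum_congr rfl fun v hv => ?_
  have hd : (0 : ℝ) < G.deg v := by exact_mod_cast InputGraph.deg_pos hv
  simp only [weight_mk, Nat.cast_ite, Nat.cast_zero]
  rw [← Finset.sum_filter, Finset.sum_const, nsmul_eq_mul, div_eq_iff hd.ne', InputGraph.out]
  push_cast; ring

theorem expect_weight_sq_le {θ : ℝ} (hθ : 0 < θ) (hθ2 : θ ^ 2 = G.numVerts * G.avgDegree) :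
    expect (Prog.edgeSample.dist G) (fun x => (x.weight : ℝ≥0∞) ^ 2) ≤
      ENNReal.ofReal (4 * θ * G.avgDegree) := by
  classical
  have h := expect_edgeSample_ofReal (G := G) (f := fun x => (x.weight : ℝ) ^ 2)
    fun x => by positivity
  simp only [ENNReal.ofReal_pow (Nat.cast_nonneg _), ENNReal.ofReal_natCast] at h
  rw [h]
  apply ENNReal.ofReal_le_ofReal
  rw [div_le_iff₀ (by exact_mod_cast G.numVerts_pos), mul_assoc, mul_comm G.avgDegree,
    ← G.sum_deg, Finset.mul_sum]
  refine Finset.sum_le_sum fun v hv => ?_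
  have hd : (0 : ℝ) < G.deg v := by exact_mod_cast InputGraph.deg_pos hv
  have ho : ((G.out v).card : ℝ) ≤ θ :=
    abs_le_of_sq_le_sq' ((G.card_out_sq_le v).trans hθ2.ge) hθ.le |>.2
  have hsum : ∑ u ∈ G.nbrs v, ((EdgeSample.weight ⟨v, u, G.deg v, G.deg u⟩ : ℕ) : ℝ) ^ 2 =
      (G.out v).card * (2 * G.deg v) ^ 2 := by
    rw [InputGraph.out, ← nsmul_eq_mul, ← Finset.sum_const, Finset.sum_filter]
    refine Finset.sum_congr rfl fun u _ => ?_
    rw [weight_mk]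
    split_ifs <;> simp
  rw [hsum, div_le_iff₀ hd]
  nlinarith [mul_pos hd hd]

open Classical in
theorem pr_lt_degTgt_eq (θ : ℝ) :
    pr (Prog.edgeSample.dist G) (fun x => θ < x.degTgt) = ENNReal.ofReal
      ((∑ v ∈ G.verts, ((G.highNbrs θ v).card : ℝ) / G.deg v) / G.numVerts) := by
  have h := expect_edgeSample_ofReal (G := G) (f := fun x => if θ < x.degTgt then 1 else 0)
    fun x => by split_ifs <;> simp
  have e : ∀ x : EdgeSample, ENNReal.ofReal (if θ < x.degTgt then 1 else 0) =
      if θ < x.degTgt then (1 : ℝ≥0∞) else 0 := fun x => by split_ifs <;> simp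
  simp only [e] at h
  rw [pr, h]
  congr 2
  refine Finset.sum_congr rfl fun v _ => ?_
  rw [← Finset.sum_filter, Finset.sum_const, nsmul_one, InputGraph.highNbrs]

-- The number of hits is 0 or 1, so fixing f at these two values covers the first and the second
-- moment at once.
open Classical in
theorem expect_hit {b : ℕ} (hb : b ∈ G.verts) {f : ℕ → ℝ≥0∞} (h0 : f 0 = 0) (h1 : f 1 = 1) :
    expect ((Prog.hit b).dist G) f = ENNReal.ofReal (G.deg b / G.numVerts) := by
  have hsub : G.nbrs b ⊆ G.verts := fun y hy => InputGraph.mem_verts_of_mem_nbrs hy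
  rw [InputGraph.deg, ← expect_unif_mem hsub]
  simp only [Prog.hit, Prog.dist_bind, expect_bind, Prog.dist_randVert]
  refine expect_congr_of_support fun a ha => ?_
  rw [PMF.mem_support_uniformOfFinset_iff] at ha
  rw [Prog.dist_edgesIn (by simp [Finset.insert_subset_iff, ha, hb]), expect_pure,
    G.edgesIn_pair]
  split_ifs <;> simp [h0, h1]

theorem dist_verdict_of_argmax {s : ℕ} {L : List EdgeSample} {e : ℕ} {x : EdgeSample}
    (h : L.argmax EdgeSample.degTgt = some x) :
    (Prog.verdict s L e).dist G = (iid ((Prog.hit x.tgt).dist G) s).bind fun H =>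
      PMF.pure (decide (1 ≤ e ∨ x.degTgt ≤ (L.map EdgeSample.weight).sum * H.sum)) := by
  rw [Prog.verdict, h]
  simp only [Prog.dist_bind, Prog.dist_replicate, Prog.dist]

-- Given `L`, the expected number of hits is sD/n with D the degree of the chosen target, so Markov
-- bounds the chance of D ≤ W·H by Ws/n. D cancels, and therefore choosing the target of largest
-- degree does not bias the test.
open Classical in
theorem pr_verdict_true_le {s : ℕ} {L : List EdgeSample} (hL : ∀ x ∈ L, x.Valid G) (e : ℕ) :
    pr ((Prog.verdict s L e).dist G) (· = true) ≤
      e + ((L.map EdgeSample.weight).sum : ℕ) * ENNReal.ofReal (s / G.numVerts) := by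
  rcases Nat.eq_zero_or_pos e with rfl | he
  · rcases hx : L.argmax EdgeSample.degTgt with _ | x
    · rw [Prog.verdict, hx]
      simp [Prog.dist, pr, expect_pure]
    · have hv := hL x (List.argmax_mem hx)
      have htV := InputGraph.mem_verts_of_mem_nbrs hv.2.1
      set W := (L.map EdgeSample.weight).sum with hW
      have hD : (0 : ℝ) < x.degTgt := by
        rw [hv.2.2.2]; exact_mod_cast InputGraph.deg_pos htV
      have hmarkov := mul_pr_le_expect (iid ((Prog.hit x.tgt).dist G) s)
        (E := fun H => x.degTgt ≤ W * H.sum)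
        (f := fun H => (W : ℝ≥0∞) * (H.map fun k : ℕ => (k : ℝ≥0∞)).sum)
        (c := (x.degTgt : ℝ≥0∞)) fun H _ hH => by
          have := natCast_sum_map H id
          simp only [List.map_id, id] at this
          rw [← this]
          exact_mod_cast hH
      rw [expect_const_mul, expect_iid_sum, expect_hit htV (by simp) (by simp),
        ← hv.2.2.2] at hmarkov
      have hpr : pr ((Prog.verdict s L 0).dist G) (· = true) =
          pr (iid ((Prog.hit x.tgt).dist G) s) fun H => x.degTgt ≤ W * H.sum := by
        rw [dist_verdict_of_argmax hx, pr_bind, pr]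
        congr 1
        funext H
        rw [pr, expect_pure, ← hW]
        simp
      rw [hpr, Nat.cast_zero, zero_add]
      have hD0 : (x.degTgt : ℝ≥0∞) ≠ 0 := by
        simpa using (by exact_mod_cast hD.ne' : x.degTgt ≠ 0)
      refine (ENNReal.mul_le_mul_iff_right hD0 (by simp)).mp (hmarkov.trans (le_of_eq ?_))
      rw [ENNReal.ofReal_div_of_pos (by exact_mod_cast G.numVerts_pos),
        ENNReal.ofReal_div_of_pos (by exact_mod_cast G.numVerts_pos), ENNReal.ofReal_natCast,
        ENNReal.ofReal_natCast, ENNReal.ofReal_natCast, ENNReal.div_eq_inv_mul,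
        ENNReal.div_eq_inv_mul]
      ring
  · refine (pr_le_one _ _).trans (le_add_of_le_of_nonneg ?_ zero_le)
    exact_mod_cast he

theorem pr_verdict_false_of_pos {s : ℕ} {L : List EdgeSample} {e : ℕ} (he : 1 ≤ e) :
    pr ((Prog.verdict s L e).dist G) (· = false) = 0 := by
  rcases hx : L.argmax EdgeSample.degTgt with _ | x
  · rw [Prog.verdict, hx]
    simp [Prog.dist, pr, expect_pure, show e ≠ 0 by omega]
  · rw [dist_verdict_of_argmax hx]
    simp [pr, he, expect_pure]

theorem pr_verdict_false_le {s : ℕ} {L : List EdgeSample} (hL : ∀ x ∈ L, x.Valid G) (e : ℕ)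
    {θ : ℝ} (hθ : 0 < θ) (hθ2 : θ ^ 2 = G.numVerts * G.avgDegree)
    (hs : 2 * (G.numVerts : ℝ) ≤ s * θ)
    (hW : s * G.avgDegree / 2 ≤ ((L.map EdgeSample.weight).sum : ℕ))
    (hhigh : ∃ x ∈ L, θ < x.degTgt) :
    pr ((Prog.verdict s L e).dist G) (· = false) ≤
      ENNReal.ofReal (4 * (G.numVerts / (s * θ))) := by
  set n : ℝ := (G.numVerts : ℝ) with hn
  have hn0 : 0 < n := by rw [hn]; exact_mod_cast G.numVerts_pos
  have hs0 : (0 : ℝ) < s := by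
    by_contra hcon
    rw [not_lt] at hcon
    nlinarith
  obtain ⟨y, hy, hyθ⟩ := hhigh
  obtain ⟨x, hx⟩ : ∃ x, L.argmax EdgeSample.degTgt = some x := by
    rcases h : L.argmax EdgeSample.degTgt with _ | x
    · rw [List.argmax_eq_none] at h
      simp [h] at hy
    · exact ⟨x, rfl⟩
  have hv := hL x (List.argmax_mem hx)
  have htV := InputGraph.mem_verts_of_mem_nbrs hv.2.1
  have hxθ : θ < x.degTgt := by
    have : y.degTgt ≤ x.degTgt := List.le_of_mem_argmax hy hx
    exact lt_of_lt_of_le hyθ (by exact_mod_cast this)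
  set W := (L.map EdgeSample.weight).sum with hWdef
  set D : ℝ := (x.degTgt : ℝ) with hD
  have hD0 : 0 < D := hθ.trans hxθ
  have h1 : expect ((Prog.hit x.tgt).dist G) (fun k => ((id k : ℕ) : ℝ≥0∞)) =
      ENNReal.ofReal (D / n) := by
    rw [expect_hit htV (by simp) (by simp), hD, hv.2.2.2]
  have h2 : expect ((Prog.hit x.tgt).dist G) (fun k => ((id k : ℕ) : ℝ≥0∞) ^ 2) ≤
      ENNReal.ofReal (D / n) := by
    rw [expect_hit htV (by simp) (by simp), hD, hv.2.2.2]
  have hcheb := pr_iid_sum_le _ id s (r := s * (D / n) / 2) (by positivity) (by positivity)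
    (by positivity) h1 h2
  rw [dist_verdict_of_argmax hx, pr_bind]
  refine le_trans ?_ (hcheb.trans (ENNReal.ofReal_le_ofReal ?_))
  · rw [pr]
    refine expect_mono fun H => ?_
    rw [pr, expect_pure, ← hWdef]
    rw [List.map_id]
    by_cases hcase : 1 ≤ e ∨ x.degTgt ≤ W * H.sum
    · simp [hcase]
    · have hfar : (s * (D / n) / 2) ^ 2 ≤ ((H.sum : ℕ) - s * (D / n)) ^ 2 := by
        rw [not_or, not_le, not_le] at hcase
        have hlt : (W : ℝ) * H.sum < D := by rw [hD]; exact_mod_cast hcase.2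
        by_contra hcon
        rw [not_le] at hcon
        have hH : s * (D / n) / 2 ≤ (H.sum : ℝ) := by
          have := abs_le_of_sq_le_sq' hcon.le (by positivity)
          linarith [this.1]
        have hprod : s * G.avgDegree / 2 * (s * (D / n) / 2) ≤ (W : ℝ) * H.sum := by
          gcongr
        -- With at least half the expected weight and half the expected hits, W·H is at least
        -- D(sθ)²/(4n²), and sθ ≥ 2n makes this at least D.
        have hsd : s * G.avgDegree / 2 * (s * (D / n) / 2) = D * ((s * θ) ^ 2 / (4 * n ^ 2)) := by
          rw [mul_pow, hθ2]; field_simp; ring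
        have hge : 1 ≤ (s * θ) ^ 2 / (4 * n ^ 2) := by
          rw [le_div_iff₀ (by positivity)]
          nlinarith
        nlinarith
      rw [if_pos hfar]
      split_ifs <;> simp
  · have e1 : s * (D / n) / (s * (D / n) / 2) ^ 2 = 4 * (n / (s * D)) := by
      field_simp; ring
    rw [e1]
    gcongr

theorem pr_round (s : ℕ) (E : Bool → Prop) :
    pr ((Prog.round s).dist G) E =
      expect (iid (Prog.edgeSample.dist G) s) fun L => expect (iid (unif G) (s + s)) fun S =>
        pr ((Prog.verdict s L (G.edgesIn S.toFinset)).dist G) E := by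
  simp only [Prog.round, Prog.dist_bind, pr_bind, Prog.dist_replicate, Prog.dist_randVert]
  congr 1
  funext L
  refine expect_congr_of_support fun S hS => ?_
  rw [Prog.dist_edgesIn, expect_pure]
  intro x hx
  exact mem_support_unif.mp (mem_support_of_mem_iid hS x (List.mem_toFinset.mp hx))

open Classical in
theorem expect_edgesIn_toFinset_le (N : ℕ) :
    expect (iid (unif G) N) (fun S => (G.edgesIn S.toFinset : ℝ≥0∞)) ≤
      ENNReal.ofReal (N ^ 2 * (G.avgDegree / G.numVerts) / 2) := by
  have hn0 : (0 : ℝ) < G.numVerts := by exact_mod_cast G.numVerts_pos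
  have hd0 : 0 ≤ G.avgDegree := zero_le_one.trans G.one_le_avgDegree
  have hpair := expect_iid_sum_sum_le (unif G)
    (fun x y => ((if y ∈ G.nbrs x then 1 else 0 : ℕ) : ℝ≥0∞)) N
  have hdiag : ∀ x, x ∉ G.nbrs x := fun x h => G.graph.irrefl (InputGraph.mem_nbrs.mp h)
  have hrow : ∀ x, expect (unif G) (fun y => ((if y ∈ G.nbrs x then 1 else 0 : ℕ) : ℝ≥0∞)) =
      ENNReal.ofReal (G.deg x / G.numVerts) := by
    intro x
    rw [InputGraph.deg, ← expect_unif_mem fun y hy => InputGraph.mem_verts_of_mem_nbrs hy]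
    congr 1; funext y; split_ifs <;> simp
  simp only [hdiag, if_false, Nat.cast_zero, expect_const, mul_zero, zero_add, hrow] at hpair
  rw [expect_unif_ofReal fun x => by positivity, ← Finset.sum_div, G.sum_deg,
    mul_div_cancel_left₀ _ hn0.ne'] at hpair
  have h2 : 2 * expect (iid (unif G) N) (fun S => (G.edgesIn S.toFinset : ℝ≥0∞)) ≤
      (N : ℝ≥0∞) ^ 2 * ENNReal.ofReal (G.avgDegree / G.numVerts) := by
    rw [← expect_const_mul]
    refine le_trans (expect_mono fun S => ?_) hpair
    have := G.two_mul_edgesIn_toFinset_le S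
    have h3 : ((2 * G.edgesIn S.toFinset : ℕ) : ℝ≥0∞) ≤ _ := Nat.cast_le.mpr this
    simp only [natCast_sum_map] at h3
    rw [Nat.cast_mul, Nat.cast_ofNat] at h3
    exact h3
  rw [ENNReal.ofReal_div_of_pos (by norm_num), ENNReal.ofReal_ofNat,
    ENNReal.le_div_iff_mul_le (by simp) (by simp), mul_comm, ENNReal.ofReal_mul (by positivity),
    ENNReal.ofReal_pow (by positivity), ENNReal.ofReal_natCast]
  exact h2

/-- A round with few samples is unlikely to succeed. -/
theorem pr_round_true_le (s : ℕ) : pr ((Prog.round s).dist G) (· = true) ≤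
    ENNReal.ofReal (3 * s ^ 2 * (G.avgDegree / G.numVerts)) := by
  have hn0 : (0 : ℝ) < G.numVerts := by exact_mod_cast G.numVerts_pos
  have hd0 : 0 ≤ G.avgDegree := zero_le_one.trans G.one_le_avgDegree
  rw [pr_round]
  calc _ ≤ expect (iid (Prog.edgeSample.dist G) s) fun L => expect (iid (unif G) (s + s)) fun S =>
        (G.edgesIn S.toFinset : ℝ≥0∞) + (L.map fun x => (x.weight : ℝ≥0∞)).sum *
          ENNReal.ofReal (s / G.numVerts) := by
        refine expect_mono_of_support fun L hL => expect_mono fun S => ?_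
        rw [← natCast_sum_map]
        exact pr_verdict_true_le
          (fun x hx => valid_of_mem_support (mem_support_of_mem_iid hL x hx)) _
    _ = expect (iid (unif G) (s + s)) (fun S => (G.edgesIn S.toFinset : ℝ≥0∞)) +
          s * ENNReal.ofReal G.avgDegree * ENNReal.ofReal (s / G.numVerts) := by
        simp only [expect_add, expect_const, expect_mul_const, expect_iid_sum, expect_weight]
    _ ≤ ENNReal.ofReal (((s + s : ℕ) : ℝ) ^ 2 * (G.avgDegree / G.numVerts) / 2) +
          ENNReal.ofReal (s * G.avgDegree * (s / G.numVerts)) := by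
        gcongr
        · exact expect_edgesIn_toFinset_le _
        · rw [ENNReal.ofReal_mul (by positivity), ENNReal.ofReal_mul (by positivity),
            ENNReal.ofReal_natCast]
    _ = _ := by
        rw [← ENNReal.ofReal_add (by positivity) (by positivity)]
        congr 1
        push_cast
        field_simp
        ring

/-- A round with many samples is likely to succeed. -/
theorem pr_round_false_le {θ : ℝ} (hθ : 0 < θ) (hθ2 : θ ^ 2 = G.numVerts * G.avgDegree) {s : ℕ}
    (hs : 2 * (G.numVerts : ℝ) ≤ s * θ) :
    pr ((Prog.round s).dist G) (· = false) ≤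
      ENNReal.ofReal (24 * (G.numVerts / (s * θ))) := by
  classical
  have hd0 : 0 < G.avgDegree := zero_lt_one.trans_le G.one_le_avgDegree
  have hsplit := G.sum_sameSide_add_sum_highNbrs (θ := θ)
  set n : ℝ := (G.numVerts : ℝ) with hn
  have hn0 : 0 < n := by rw [hn]; exact_mod_cast G.numVerts_pos
  have hs0 : (0 : ℝ) < s := by
    by_contra hcon
    rw [not_lt] at hcon
    nlinarith
  have hs0' : 0 < s := by exact_mod_cast hs0
  set ν : ℝ := n / (s * θ) with hν
  have hν0 : 0 < ν := by positivity
  rw [pr_round]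
  by_cases hcase : θ ^ 2 / 2 ≤ ∑ x ∈ G.verts, ((G.sameSide θ x).card : ℝ)
  · calc _ ≤ expect (iid (Prog.edgeSample.dist G) s) fun _ =>
          pr (iid (unif G) (s + s)) fun S => G.edgesIn S.toFinset = 0 := by
          refine expect_mono fun L => ?_
          rw [pr]
          refine expect_mono fun S => ?_
          by_cases h0 : G.edgesIn S.toFinset = 0
          · rw [if_pos h0]; exact pr_le_one _ _
          · rw [pr_verdict_false_of_pos (Nat.one_le_iff_ne_zero.mpr h0)]; exact zero_le
      _ ≤ ENNReal.ofReal (6 * ν) := by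
          rw [expect_const]
          exact pr_edgesIn_eq_zero_le hθ hθ2 hcase (by linarith)
      _ ≤ _ := ENNReal.ofReal_le_ofReal (by linarith)
  · rw [not_le] at hcase
    rw [← hθ2] at hsplit
    set μ := (∑ v ∈ G.verts, ((G.highNbrs θ v).card : ℝ) / G.deg v) / n with hμ
    -- The crossing edges contribute more than θ²/4 seen from their low ends, and a low end of
    -- degree at most θ picks each of them with probability at least 1/θ.
    have hμle : θ / (4 * n) ≤ μ := by
      rw [hμ, le_div_iff₀ hn0]
      have h1 : (∑ x ∈ G.verts.filter (fun x => (G.deg x : ℝ) ≤ θ),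
          ((G.highNbrs θ x).card : ℝ)) / θ ≤
            ∑ v ∈ G.verts, ((G.highNbrs θ v).card : ℝ) / G.deg v := by
        rw [Finset.sum_div]
        refine (Finset.sum_le_sum fun x hx => ?_).trans
          (Finset.sum_le_sum_of_subset_of_nonneg (Finset.filter_subset _ _)
            fun _ _ _ => by positivity)
        rw [Finset.mem_filter] at hx
        have : (0 : ℝ) < G.deg x := by exact_mod_cast InputGraph.deg_pos hx.1
        gcongr
        exact hx.2
      refine le_trans ?_ h1
      rw [le_div_iff₀ hθ]
      have : θ / (4 * n) * n * θ = θ ^ 2 / 4 := by field_simp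
      rw [this]
      linarith
    have hμ0 : 0 < μ := lt_of_lt_of_le (by positivity) hμle
    have hhigh := pr_iid_forall_not_le (Prog.edgeSample.dist G) (fun x => θ < x.degTgt) hs0' hμ0
      (pr_lt_degTgt_eq θ)
    have hweight := pr_iid_sum_le (Prog.edgeSample.dist G) EdgeSample.weight s
      (r := s * G.avgDegree / 2) hd0.le (by positivity) (by positivity) expect_weight
      (expect_weight_sq_le hθ hθ2)
    -- Three ways to fail: the weight is off by half its mean (16ν), no sampled target has degree
    -- above θ (4ν), or the hits on the chosen target are too few (4ν).
    calc _ ≤ expect (iid (Prog.edgeSample.dist G) s) fun L =>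
          ((if (s * G.avgDegree / 2) ^ 2 ≤
            (((L.map EdgeSample.weight).sum : ℕ) - s * G.avgDegree) ^ 2 then 1 else 0) +
              if ∀ x ∈ L, ¬ θ < x.degTgt then 1 else 0) + ENNReal.ofReal (4 * ν) := by
          refine expect_mono_of_support fun L hL => ?_
          rw [← expect_const (iid (unif G) (s + s))
            ((_ + _) + ENNReal.ofReal (4 * ν))]
          refine expect_mono fun S => ?_
          by_cases h1 : (s * G.avgDegree / 2) ^ 2 ≤
              (((L.map EdgeSample.weight).sum : ℕ) - s * G.avgDegree) ^ 2
          · rw [if_pos h1, add_assoc]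
            exact (pr_le_one _ _).trans le_self_add
          by_cases h2 : ∀ x ∈ L, ¬ θ < x.degTgt
          · rw [if_pos h2, add_comm, ← add_assoc]
            exact (pr_le_one _ _).trans le_add_self
          rw [if_neg h1, if_neg h2, zero_add, zero_add]
          push Not at h1 h2
          obtain ⟨x, hx, hxθ⟩ := h2
          refine pr_verdict_false_le
            (fun x hx => valid_of_mem_support (mem_support_of_mem_iid hL x hx)) _ hθ hθ2 hs ?_
            ⟨x, hx, hxθ⟩
          have := (abs_le_of_sq_le_sq' h1.le (by positivity)).1
          linarith
      _ ≤ ENNReal.ofReal (16 * ν) + ENNReal.ofReal (4 * ν) + ENNReal.ofReal (4 * ν) := by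
          rw [expect_add, expect_add, expect_const]
          gcongr ?_ + ?_ + _
          · refine hweight.trans (ENNReal.ofReal_le_ofReal (le_of_eq ?_))
            have e1 : s * (4 * θ * G.avgDegree) / (s * G.avgDegree / 2) ^ 2 =
                16 * (n * θ) / (s * (n * G.avgDegree)) := by field_simp; ring
            rw [e1, ← hθ2, hν]; field_simp
          · rw [← pr_eq_expect]
            refine hhigh.trans (ENNReal.ofReal_le_ofReal ?_)
            calc 1 / (s * μ) ≤ 1 / (s * (θ / (4 * n))) := by gcongr
              _ = 4 * ν := by rw [hν]; field_simp
      _ = _ := by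
          rw [← ENNReal.ofReal_add (by positivity) (by positivity),
            ← ENNReal.ofReal_add (by positivity) (by positivity)]
          congr 1; ring

/-! ### The estimator, its accuracy and the query counts. -/

namespace Prog

/-- The mean weight of `N` edge samples. -/
noncomputable def estimate (N : ℕ) : Prog ℝ :=
  (edgeSample.replicate N).bind fun L => ret (((L.map EdgeSample.weight).sum : ℕ) / N)

theorem safe_edgeSample (K : Finset ℕ) :
    edgeSample.Safe G (fun x K' => K ⊆ K' ∧ {x.tgt} ⊆ K') K 8 := by
  refine Safe.bind (c := 2) (c' := 6) (fun v K₁ h₁ => ?_) (safe_randVert K)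
  refine Safe.bind (c := 2) (c' := 4) (fun u K₂ h₂ => ?_)
    (safe_randNbr (by simpa using h₁.2.2) h₁.1)
  refine Safe.bind (c := 2) (c' := 2) (fun k K₃ h₃ => ?_)
    (safe_degree (h₂.1 (by simpa using h₁.2.2)))
  refine Safe.bind (c := 2) (c' := 0) (fun k' K₄ h₄ => ?_)
    (safe_degree (h₃ (by simpa using h₂.2)))
  exact ⟨h₁.2.1.trans (h₂.1.trans (h₃.trans h₄)), h₂.2.trans (h₃.trans h₄)⟩

theorem safe_hit {b : ℕ} {K : Finset ℕ} (hb : b ∈ K) :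
    (hit b).Safe G (fun _ K' => K ⊆ K' ∧ ∅ ⊆ K') K 5 := by
  refine Safe.bind (c := 2) (c' := 3) (fun a K₁ h₁ => ?_) (safe_randVert K)
  refine Safe.mono (fun _ K₂ h₂ => ⟨h₁.2.1.trans h₂, Finset.empty_subset _⟩)
    (Nat.succ_le_succ Finset.card_le_two) (safe_edgesIn ?_)
  simp only [Finset.insert_subset_iff, Finset.singleton_subset_iff]
  exact ⟨by simpa using h₁.2.2, h₁.2.1 hb⟩

theorem safe_verdict {s : ℕ} {L : List EdgeSample} {e : ℕ} {K : Finset ℕ}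
    (hL : ∀ x ∈ L, x.tgt ∈ K) : (verdict s L e).Safe G (fun _ _ => True) K (s * 5) := by
  rcases hx : L.argmax EdgeSample.degTgt with _ | x
  · rw [verdict, hx]; trivial
  · rw [verdict, hx]
    have hxK := hL x (List.argmax_mem hx)
    refine Safe.bind (c := s * 5) (c' := 0) (fun H K₁ _ => ?_) (Safe.replicate
      (V := fun _ => ∅) (K₀ := {x.tgt}) (fun K' hK' => safe_hit (by simpa using hK')) s K ?_)
    · exact True.intro
    · simpa using hxK

theorem safe_round (s : ℕ) (K : Finset ℕ) :
    (round s).Safe G (fun _ _ => True) K (19 * s + 1) := by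
  -- Edge samples, random vertices, the additive query on at most 2s vertices, and the hits, each
  -- query charged its cost plus one.
  rw [show 19 * s + 1 = s * 8 + ((s + s) * 2 + (s + s + 1 + s * 5)) by ring]
  refine Safe.bind (fun L K₁ h₁ => ?_) (Safe.replicate (K₀ := ∅)
    (V := fun x => {x.tgt}) (fun K' _ => safe_edgeSample K') s K (Finset.empty_subset _))
  refine Safe.bind (fun S K₂ h₂ => ?_) (Safe.replicate (K₀ := ∅) (V := fun x => {x})
    (fun K' _ => Safe.mono (fun _ _ h => h.2) le_rfl (safe_randVert K')) (s + s) K₁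
    (Finset.empty_subset _))
  refine Safe.bind (fun e K₃ h₃ => ?_) (Safe.mono (fun _ _ h => h)
    (c' := s + s + 1) ?_ (safe_edgesIn (S := S.toFinset) ?_))
  · refine safe_verdict fun x hx => ?_
    exact h₃ (h₂.2.1 (by simpa using h₁.2.2 x hx))
  · have := S.toFinset_card_le
    rw [h₂.1] at this
    omega
  · intro x hx
    simpa using h₂.2.2 x (List.mem_toFinset.mp hx)

theorem safe_estimate (N : ℕ) (K : Finset ℕ) :
    (estimate N).Safe G (fun _ _ => True) K (N * 8) := by
  refine Safe.bind (c := N * 8) (c' := 0) (fun _ _ _ => ?_) (Safe.replicate (K₀ := ∅)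
    (V := fun x => {x.tgt}) (fun K' _ => safe_edgeSample K') N K (Finset.empty_subset _))
  exact True.intro

/-- Test whether `s` samples suffice, and if so, estimate the average degree from `N` samples. -/
noncomputable def testAndEstimate (s N : ℕ) : Prog (Option ℝ) :=
  (round s).bind fun b => if b then (estimate N).bind fun v => ret (some v) else ret none

theorem safe_testAndEstimate (s N : ℕ) (K : Finset ℕ) :
    (testAndEstimate s N).Safe G (fun _ _ => True) K (19 * s + 1 + N * 8) := by
  refine Safe.bind (fun b K₁ _ => ?_) (safe_round s K)
  cases b with
  | false => exact trivial
  | true =>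
    refine Safe.bind (c := N * 8) (c' := 0) (fun _ _ _ => ?_) (safe_estimate N K₁)
    exact True.intro

end Prog

theorem pr_not_isApprox_estimate_le {θ ε : ℝ} (hθ : 0 < θ)
    (hθ2 : θ ^ 2 = G.numVerts * G.avgDegree) (hε : 0 < ε) (hε1 : ε < 1) {N : ℕ} (hN : 0 < N) :
    pr ((Prog.estimate N).dist G) (fun v => ¬ IsApprox (1 + ε) G.avgDegree v) ≤
      ENNReal.ofReal (16 * G.numVerts / (N * ε ^ 2 * θ)) := by
  have hd0 : 0 < G.avgDegree := zero_lt_one.trans_le G.one_le_avgDegree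
  have hN0 : (0 : ℝ) < N := by exact_mod_cast hN
  have hn0 : (0 : ℝ) < G.numVerts := by exact_mod_cast G.numVerts_pos
  have hweight := pr_iid_sum_le (Prog.edgeSample.dist G) EdgeSample.weight N
    (r := N * (ε * G.avgDegree / 2)) hd0.le (by positivity) (by positivity) expect_weight
    (expect_weight_sq_le hθ hθ2)
  have hpr : pr ((Prog.estimate N).dist G) (fun v => ¬ IsApprox (1 + ε) G.avgDegree v) =
      pr (iid (Prog.edgeSample.dist G) N) fun L => ¬ IsApprox (1 + ε) G.avgDegree
        (((L.map EdgeSample.weight).sum : ℕ) / N) := by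
    simp only [Prog.estimate, Prog.dist_bind, Prog.dist_replicate, Prog.dist, pr, expect_bind,
      expect_pure]
  rw [hpr]
  refine (pr_mono fun L _ hL => ?_).trans (hweight.trans (le_of_eq ?_))
  · by_contra hcon
    rw [not_le] at hcon
    apply hL
    set W : ℝ := (((L.map EdgeSample.weight).sum : ℕ) : ℝ) with hW
    obtain ⟨h1, h2⟩ := abs_le_of_sq_le_sq' hcon.le (by positivity)
    have hlo : (1 - ε / 2) * G.avgDegree ≤ W / N := by
      rw [le_div_iff₀ hN0]; linarith
    have hhi : W / N ≤ (1 + ε / 2) * G.avgDegree := by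
      rw [div_le_iff₀ hN0]; linarith
    constructor
    · refine le_trans ?_ hlo
      rw [div_le_iff₀ (by positivity)]
      -- Half the tolerance is needed on the lower side, where the requirement d/(1 + ε) is larger
      -- than (1 - ε)d.
      have : 1 ≤ (1 - ε / 2) * (1 + ε) := by nlinarith
      nlinarith
    · refine hhi.trans ?_
      gcongr
      linarith
  · congr 1
    have e1 : N * (4 * θ * G.avgDegree) / (N * (ε * G.avgDegree / 2)) ^ 2 =
        16 * (G.numVerts * θ) / (N * ε ^ 2 * (G.numVerts * G.avgDegree)) := by
      field_simp; ring
    rw [e1, ← hθ2]; field_simp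

/-! ### The error of the doubling search. -/

section FirstReturn

variable (s N : ℕ → ℕ)

theorem firstReturn_testAndEstimate (E : ℝ → Prop) (R j : ℕ) :
    firstReturn (fun j => Prog.testAndEstimate (s j) (N j)) G E (R + 1) j =
      expect ((Prog.round (s j)).dist G) fun b =>
        if b then pr ((Prog.estimate (N j)).dist G) E
        else firstReturn (fun j => Prog.testAndEstimate (s j) (N j)) G E R (j + 1) := by
  rw [firstReturn, Prog.testAndEstimate, Prog.dist_bind, expect_bind]
  congr 1
  funext b
  cases b with
  | false => simp [Prog.dist, expect_pure]
  | true => simp [Prog.dist, Prog.dist_bind, expect_bind, expect_pure, pr]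

/-- If the estimates from round `j₀` on are reliable, and round `j₁` is likely to be the last one,
then the probability of failure is at most that of stopping before round `j₀`, plus the error
probabilities. -/
theorem one_le_firstReturn_add {E : ℝ → Prop} {j₀ j₁ : ℕ} {δ η : ℝ≥0∞} (hj : j₀ ≤ j₁)
    (hδ : ∀ j, j₀ ≤ j → pr ((Prog.estimate (N j)).dist G) (fun v => ¬ E v) ≤ δ)
    (hη : pr ((Prog.round (s j₁)).dist G) (· = false) ≤ η) (i : ℕ) (hi : i ≤ j₁) :
    1 ≤ firstReturn (fun j => Prog.testAndEstimate (s j) (N j)) G E (i + 1) (j₁ - i) +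
      (δ + η + ∑ k ∈ Finset.Ico (j₁ - i) j₀, pr ((Prog.round (s k)).dist G) (· = true)) := by
  classical
  have hgood : ∀ j, j₀ ≤ j → 1 ≤ pr ((Prog.estimate (N j)).dist G) E + δ := fun j hj =>
    (pr_add_pr_not ((Prog.estimate (N j)).dist G) E).symm.le.trans (by gcongr; exact hδ j hj)
  induction i with
  | zero =>
    rw [Nat.sub_zero, Finset.Ico_eq_empty (by omega), Finset.sum_empty, add_zero]
    calc (1 : ℝ≥0∞) = expect ((Prog.round (s j₁)).dist G) fun _ => 1 := (expect_const _ _).symm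
      _ ≤ expect ((Prog.round (s j₁)).dist G) fun b =>
          (if b then pr ((Prog.estimate (N j₁)).dist G) E
            else firstReturn (fun j => Prog.testAndEstimate (s j) (N j)) G E 0 (j₁ + 1)) +
              (δ + if b = false then 1 else 0) := by
          refine expect_mono fun b => ?_
          cases b with
          | false => simp only [if_true]; rw [← add_assoc]; exact le_add_self
          | true => simpa using hgood j₁ hj
      _ ≤ _ := by
          rw [firstReturn_testAndEstimate, expect_add, expect_add, expect_const]
          gcongr
          refine le_trans (le_of_eq ?_) hη
          rw [pr_eq_expect]
  | succ i ih =>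
    have hstep : j₁ - (i + 1) + 1 = j₁ - i := by omega
    have ih' := ih (by omega)
    rw [firstReturn_testAndEstimate, hstep]
    set j := j₁ - (i + 1) with hjdef
    set y := δ + η + ∑ k ∈ Finset.Ico (j₁ - i) j₀, pr ((Prog.round (s k)).dist G) (· = true)
    set F := firstReturn (fun j => Prog.testAndEstimate (s j) (N j)) G E (i + 1) (j₁ - i)
    -- From round j₀ on, either branch of the test is within the same error, so δ is charged once
    -- and not per round: only a successful round runs an estimate. An earlier round is charged its
    -- whole probability of success.
    rcases le_or_gt j₀ j with hjj | hjj
    · rw [Finset.Ico_eq_empty (by omega), Finset.sum_empty, add_zero]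
      have hy : y = δ + η := by
        simp only [y]
        rw [Finset.Ico_eq_empty (by omega), Finset.sum_empty, add_zero]
      rw [hy] at ih'
      rw [← expect_const ((Prog.round (s j)).dist G) (δ + η), ← expect_add,
        ← expect_const ((Prog.round (s j)).dist G) 1]
      refine expect_mono fun b => ?_
      cases b with
      | false => simpa using ih'
      | true =>
        simp only [if_true]
        rw [← add_assoc]
        exact (hgood j hjj).trans le_self_add
    · have hsum : δ + η + ∑ k ∈ Finset.Ico j j₀, pr ((Prog.round (s k)).dist G) (· = true) =
          y + pr ((Prog.round (s j)).dist G) (· = true) := by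
        rw [Finset.sum_eq_sum_Ico_succ_bot hjj, hstep]
        simp only [y]; ring
      rw [hsum, pr_eq_expect ((Prog.round (s j)).dist G),
        ← expect_const ((Prog.round (s j)).dist G) y, ← expect_add, ← expect_add,
        ← expect_const ((Prog.round (s j)).dist G) 1]
      refine expect_mono fun b => ?_
      cases b with
      | false => simpa using ih'
      | true =>
        refine (self_le_add_left (1 : ℝ≥0∞) (pr ((Prog.estimate (N j)).dist G) E + y)).trans ?_
        simp [add_assoc, expect_const]

end FirstReturn

/-! ### The upper bound algorithm and its constants. -/

/-- The algorithm of the upper bound: rounds with `1, 2, 4, …` samples, until one succeeds. -/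
noncomputable def averageDegreeAlgorithm (ε : ℝ) : Algorithm :=
  loop fun j => Prog.testAndEstimate (2 ^ j) ⌈256000 * 2 ^ j / ε ^ 2⌉₊

theorem exists_two_pow_near {x : ℝ} (hx : 1 ≤ x) :
    ∃ j : ℕ, x ≤ 2 ^ j ∧ (2 : ℝ) ^ j ≤ 2 * x := by
  have hex : ∃ j : ℕ, x ≤ 2 ^ j := by
    obtain ⟨j, hj⟩ := pow_unbounded_of_one_lt x (one_lt_two : (1 : ℝ) < 2)
    exact ⟨j, hj.le⟩
  classical
  refine ⟨Nat.find hex, Nat.find_spec hex, ?_⟩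
  rcases h : Nat.find hex with _ | j
  · rw [pow_zero]; linarith
  · have := Nat.find_min hex (m := j) (by omega)
    rw [not_le] at this
    rw [pow_succ]; linarith

theorem averageDegreeAlgorithm_prob (G : InputGraph) {ε : ℝ} (hε : 0 < ε) (hε1 : ε < 1) :
    99 / 100 < (averageDegreeAlgorithm ε).prob G (fun v q =>
      IsApprox (1 + ε) G.avgDegree v ∧
      (q : ℝ) ≤ 100000000000 * (1 / ε ^ 2) * Real.sqrt ((G.numVerts : ℝ) / G.avgDegree)) := by
  have hd1 := G.one_le_avgDegree
  have hdn := G.avgDegree_le_numVerts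
  set d := G.avgDegree with hd
  set n : ℝ := (G.numVerts : ℝ) with hn
  have hd0 : 0 < d := zero_lt_one.trans_le hd1
  have hn0 : 0 < n := hd0.trans_le hdn
  set X := Real.sqrt (n / d) with hX
  have hX2 : X ^ 2 = n / d := Real.sq_sqrt (by positivity)
  have hX1 : 1 ≤ X := Real.one_le_sqrt.mpr ((one_le_div hd0).mpr hdn)
  have hX0 : 0 < X := by linarith
  set θ := n / X with hθdef
  have hθ : 0 < θ := by positivity
  have hθ2 : θ ^ 2 = n * d := by
    rw [hθdef, div_pow, hX2]; field_simp
  have hratio : ∀ a : ℝ, n / (a * θ) = X / a := by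
    intro a
    rw [hθdef]
    field_simp
  set N : ℕ → ℕ := fun j => ⌈256000 * 2 ^ j / ε ^ 2⌉₊ with hN
  have hNlo : ∀ j, 256000 * 2 ^ j / ε ^ 2 ≤ (N j : ℝ) := fun j => Nat.le_ceil _
  have hNhi : ∀ j, (N j : ℝ) ≤ 256001 * 2 ^ j / ε ^ 2 := by
    intro j
    have h1 : (N j : ℝ) < 256000 * 2 ^ j / ε ^ 2 + 1 := Nat.ceil_lt_add_one (by positivity)
    have h2 : 1 ≤ 2 ^ j / ε ^ 2 := by
      rw [one_le_div (by positivity)]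
      have h3 : ε ^ 2 ≤ 1 := pow_le_one₀ hε.le hε1.le
      exact h3.trans (one_le_pow₀ (by norm_num))
    calc (N j : ℝ) ≤ 256000 * 2 ^ j / ε ^ 2 + 2 ^ j / ε ^ 2 := by linarith
      _ = _ := by ring
  have hN0 : ∀ j, 0 < N j := fun j => Nat.ceil_pos.mpr (by positivity)
  -- the round from which on estimates are reliable
  obtain ⟨j₀, hj₀, hα⟩ : ∃ j₀ : ℕ, X ≤ 40 * 2 ^ j₀ ∧
      ∑ k ∈ Finset.range j₀, 3 * ((2 : ℝ) ^ k) ^ 2 * (d / n) ≤ 1 / 400 := by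
    -- Since 3·4^k telescopes, the total probability of stopping before round j₀ is below 4^j₀/X²,
    -- which is at most 1/400 once 2^j₀ ≤ X/20.
    have hgeom : ∀ j : ℕ, ∑ k ∈ Finset.range j, 3 * ((2 : ℝ) ^ k) ^ 2 * (d / n) =
        ((2 ^ j) ^ 2 - 1) / X ^ 2 := by
      intro j
      induction j with
      | zero => simp
      | succ j ih =>
        rw [Finset.sum_range_succ, ih, hX2]
        field_simp
        ring
    rcases le_or_gt X 40 with h40 | h40
    · exact ⟨0, by simpa using h40, by norm_num⟩
    · obtain ⟨j₀, h1, h2⟩ := exists_two_pow_near (x := X / 40) (by linarith)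
      refine ⟨j₀, by linarith, ?_⟩
      rw [hgeom, div_le_iff₀ (by positivity)]
      have : (2 : ℝ) ^ j₀ ≤ X / 20 := by linarith
      have h3 : ((2 : ℝ) ^ j₀) ^ 2 ≤ (X / 20) ^ 2 := by gcongr
      linarith
  obtain ⟨j₁, hj₁, hj₁'⟩ := exists_two_pow_near (x := 9600 * X) (by linarith)
  -- Passing to the minimum secures the order of the two rounds, and both properties of j₀ survive
  -- it.
  have hj : j₀ ⊓ j₁ ≤ j₁ := inf_le_right
  have hj₀' : X ≤ 40 * 2 ^ (j₀ ⊓ j₁) := by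
    rcases le_total j₀ j₁ with h | h
    · rwa [inf_eq_left.mpr h]
    · rw [inf_eq_right.mpr h]; linarith
  have hα' : ∑ k ∈ Finset.range (j₀ ⊓ j₁), 3 * ((2 : ℝ) ^ k) ^ 2 * (d / n) ≤ 1 / 400 :=
    (Finset.sum_le_sum_of_subset_of_nonneg (Finset.range_mono inf_le_left)
      fun _ _ _ => by positivity).trans hα
  have hmain := one_le_firstReturn_add (G := G) (fun j => 2 ^ j) N
    (E := IsApprox (1 + ε) d) (δ := ENNReal.ofReal (1 / 400)) (η := ENNReal.ofReal (1 / 400)) hj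
    (fun j hjj => ?_) ?_ j₁ le_rfl
  · rw [Nat.sub_self] at hmain
    have herr : ENNReal.ofReal (1 / 400) + ENNReal.ofReal (1 / 400) +
        ∑ k ∈ Finset.Ico 0 (j₀ ⊓ j₁), pr ((Prog.round (2 ^ k)).dist G) (· = true) ≤
          ENNReal.ofReal (3 / 400) := by
      calc _ ≤ ENNReal.ofReal (1 / 400) + ENNReal.ofReal (1 / 400) +
            ∑ k ∈ Finset.range (j₀ ⊓ j₁), ENNReal.ofReal (3 * ((2 : ℝ) ^ k) ^ 2 * (d / n)) := by
            rw [← Finset.range_eq_Ico]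
            gcongr with k _
            refine (pr_round_true_le (2 ^ k)).trans (le_of_eq ?_)
            push_cast; rfl
        _ ≤ ENNReal.ofReal (1 / 400) + ENNReal.ofReal (1 / 400) + ENNReal.ofReal (1 / 400) := by
            rw [← ENNReal.ofReal_sum_of_nonneg fun _ _ => by positivity]
            gcongr
        _ = _ := by
            rw [← ENNReal.ofReal_add (by norm_num) (by norm_num),
              ← ENNReal.ofReal_add (by norm_num) (by norm_num)]
            norm_num
    have hfr := hmain.trans (add_le_add le_rfl herr)
    refine lt_of_lt_of_le ?_ (firstReturn_le_prob_loop _ (c := fun j => 19 * 2 ^ j + 1 + N j * 8)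
      (fun j K => Prog.safe_testAndEstimate _ _ K) _ (j₁ + 1) fun v q hv hq => ⟨hv, ?_⟩)
    · by_contra hcon
      rw [not_lt] at hcon
      have h1 := hfr.trans (add_le_add hcon le_rfl)
      have h2 : (99 / 100 : ℝ≥0∞) = ENNReal.ofReal (99 / 100) := by
        rw [ENNReal.ofReal_div_of_pos (by norm_num)]; norm_num
      rw [h2, ← ENNReal.ofReal_add (by norm_num) (by norm_num), ENNReal.one_le_ofReal] at h1
      norm_num at h1
    · have hcost : ∀ j, ((19 * 2 ^ j + 1 + N j * 8 + 1 : ℕ) : ℝ) ≤ 2048029 * 2 ^ j / ε ^ 2 := by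
        intro j
        have h1 := hNhi j
        have h2 : (2 : ℝ) ^ j ≤ 2 ^ j / ε ^ 2 := by
          rw [le_div_iff₀ (by positivity)]
          exact mul_le_of_le_one_right (by positivity) (pow_le_one₀ hε.le hε1.le)
        have h3 : (1 : ℝ) ≤ 2 ^ j := one_le_pow₀ (by norm_num)
        push_cast
        calc (19 * 2 ^ j + 1 + N j * 8 + 1 : ℝ)
            ≤ 21 * (2 ^ j / ε ^ 2) + 8 * (256001 * 2 ^ j / ε ^ 2) := by linarith
          _ = 2048029 * 2 ^ j / ε ^ 2 := by ring
      -- The round costs grow geometrically, so the total is at most twice the bound for round j₁,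
      -- and no logarithm arises.
      have hgeom : ∑ j ∈ Finset.range (j₁ + 1), (2 : ℝ) ^ j ≤ 2 * 2 ^ j₁ := by
        rw [geom_sum_eq (by norm_num), pow_succ]
        linarith
      calc (q : ℝ) ≤ ((∑ j ∈ Finset.range (j₁ + 1), (19 * 2 ^ j + 1 + N j * 8 + 1) : ℕ) : ℝ) := by
            exact_mod_cast hq
        _ ≤ ∑ j ∈ Finset.range (j₁ + 1), 2048029 * 2 ^ j / ε ^ 2 := by
            rw [Nat.cast_sum]
            exact Finset.sum_le_sum fun j _ => hcost j
        _ = 2048029 / ε ^ 2 * ∑ j ∈ Finset.range (j₁ + 1), (2 : ℝ) ^ j := by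
            rw [Finset.mul_sum]
            exact Finset.sum_congr rfl fun j _ => by ring
        _ ≤ 2048029 / ε ^ 2 * (2 * (2 * (9600 * X))) := by
            gcongr
            linarith
        _ = 2048029 * 38400 * (1 / ε ^ 2) * X := by ring
        _ ≤ _ := by gcongr; norm_num
  -- 256000 = 16 · 40 · 400: the error 16X/(256000 · 2^j) is at most 1/400 because X ≤ 40 · 2^j.
  · refine (pr_not_isApprox_estimate_le hθ hθ2 hε hε1 (hN0 j)).trans
      (ENNReal.ofReal_le_ofReal ?_)
    have h1 : 256000 * 2 ^ j ≤ N j * ε ^ 2 := (div_le_iff₀ (by positivity)).mp (hNlo j)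
    have h2 : (2 : ℝ) ^ (j₀ ⊓ j₁) ≤ 2 ^ j := pow_le_pow_right₀ (by norm_num) hjj
    have hpos : 0 < N j * ε ^ 2 := lt_of_lt_of_le (by positivity) h1
    rw [← hn, mul_div_assoc, hratio, mul_div_assoc', div_le_iff₀ hpos]
    linarith
  -- 9600 = 24 · 400 makes the failure bound 24X/2^j₁ at most 1/400.
  · refine (pr_round_false_le hθ hθ2 (s := 2 ^ j₁) ?_).trans (ENNReal.ofReal_le_ofReal ?_)
    · push_cast
      rw [← hn, hθdef, mul_div_assoc', le_div_iff₀ hX0]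
      nlinarith
    · push_cast
      rw [← hn, hratio, mul_div_assoc', div_le_iff₀ (by positivity)]
      linarith

end AvgDegree

theorem theorem1p4 :
    (∃ (A : ℝ → AvgDegree.Algorithm) (C : ℝ) (k : ℕ), 0 < C ∧
      ∀ ε : ℝ, 0 < ε → ε < 1 →
        (A ε).InModel AvgDegree.advancedModel ∧
        ∀ G : AvgDegree.InputGraph,
          (A ε).OnlyDiscovered G ∧
          99 / 100 < (A ε).prob G (fun v q =>
            AvgDegree.IsApprox (1 + ε) G.avgDegree v ∧
            (q : ℝ) ≤ C * (1 / ε ^ 2) * Real.sqrt ((G.numVerts : ℝ) / G.avgDegree) *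
              Real.log (G.numVerts : ℝ) ^ k)) ∧
    (∀ c : ℝ, 1 < c → ∃ κ : ℝ, 0 < κ ∧
      ∀ A : AvgDegree.Algorithm,
        (∀ G : AvgDegree.InputGraph,
          2 / 3 ≤ A.prob G (fun v _ => AvgDegree.IsApprox c G.avgDegree v)) →
        ∀ (n : ℕ) (d : ℝ), 1 ≤ d → d ≤ (n : ℝ) - 1 →
          ∃ G : AvgDegree.InputGraph,
            G.numVerts = n ∧ d / 2 ≤ G.avgDegree ∧ G.avgDegree ≤ 2 * d ∧
            1 / 4 ≤ A.prob G (fun _ q =>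
              κ * Real.sqrt ((G.numVerts : ℝ) / G.avgDegree) ≤ (q : ℝ))) := by
  -- The exponent of the logarithm is 0.
  refine ⟨⟨AvgDegree.averageDegreeAlgorithm, 100000000000, 0, by norm_num, fun ε hε hε1 =>
    ⟨AvgDegree.loop_inModel _, fun G => ⟨AvgDegree.loop_onlyDiscovered _
      fun j K => AvgDegree.Prog.safe_testAndEstimate _ _ K, ?_⟩⟩⟩, fun c hc => ?_⟩
  · simpa only [pow_zero, mul_one] using AvgDegree.averageDegreeAlgorithm_prob G hε hε1
  · exact ⟨1 / (20 * (c + 2)), by positivity, fun A hA n d hd hdn =>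
      AvgDegree.exists_graph_with_many_queries hc A hA n d hd hdn⟩
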